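/- Let $d\ge 1$ and $N$ be natural numbers, let $a>0$, and let $P$ be an atomless Borel probability measure on $\mathbb{R}$ with $P([-a,a])=1$. Write $m_k=\int x^k\,dP$ and assume $m_1=0$ and $m_3=0$. Let $x_{ij}$ ($1\le i\le N$, $1\le j\le d$) be independent random variables with common law $P$, let $\mathbf p_i=(x_{i1},\dots,x_{id})$ be the resulting $N$ random points, almost surely in $[-a,a]^d$, and let $\Delta\in\mathbb{R}^{N\times N}$, $\Delta(i,j)=\|\mathbf p_i-\mathbf p_j\|_2^2$, be their Euclidean distance matrix. Put $$\zeta=d(m_4-m_2^2)+d^2m_2^2+1,\qquad \lambda^*=\min\Big\{\zeta-\sqrt{\zeta^2-4d(m_4-m_2^2)},\;2m_2\Big\},\qquad \theta=\frac{2(1+da^2+d^2a^4)}{\lambda^*}.$$ For a subspace $U\subseteq\mathbb{R}^N$ of dimension $r$, with orthogonal projection $P_U$, the coherence is $\mu(U)=\frac Nr\max_{i}\|P_U e_i\|_2^2$. For a matrix $M\in\mathbb{R}^{K\times L}$ of rank $r$ with column space $U$, row space $V$ and compact singular value decomposition $M=\sum_{k=1}^r\sigma_k u_kv_k^{T}$,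 say that $M$ obeys A0 with constant $\mu_0>0$ if $\max\{\mu(U),\mu(V)\}\le\mu_0$, and A1 with constant $\mu_1>0$ if every entry of $\sum_{k=1}^r u_kv_k^{T}$ has absolute value at most $\mu_1\sqrt{r/(KL)}$. Let $t\in(0,1)$ and $\gamma\in(0,1]$. If $$N\;\ge\;\frac{2\theta\,(\log(d+2)-\log\gamma)}{(1-t)^2},$$ then the rank of $\Delta$ is at most $d+2$ everywhere, and with probability at least $1-\gamma$ the matrix $\Delta$ has rank $d+2$ and obeys A0 and A1 with constants $$\mu_0=\frac{\theta}{t(d+2)}\qquad\text{and}\qquad \mu_1=\frac{\theta}{t\sqrt{d+2}}.$$ -/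

import Mathlib

open MeasureTheory ProbabilityTheory

noncomputable section

namespace RandomEDM

/-- The Euclidean distance matrix of the points `p 0, …, p (N - 1)` of `ℝ^d`; its entries are the
squared Euclidean distances. -/
def edm {N d : ℕ} (p : Fin N → EuclideanSpace ℝ (Fin d)) : Matrix (Fin N) (Fin N) ℝ :=
  Matrix.of fun i j => ‖p i - p j‖ ^ 2

/-- The coherence `(N / r) * max_i ‖P_U e_i‖²` of an `r`-dimensional subspace `U` of `ℝ^N` with
respect to the standard basis. -/
def coherence {N : ℕ} (U : Submodule ℝ (EuclideanSpace ℝ (Fin N))) : ℝ :=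
  (N : ℝ) / (Module.finrank ℝ U : ℝ) *
    ⨆ i : Fin N, ‖U.starProjection (EuclideanSpace.single i (1 : ℝ))‖ ^ 2

/-- The column space of a matrix. -/
def colSpace {K L : ℕ} (M : Matrix (Fin K) (Fin L) ℝ) : Submodule ℝ (EuclideanSpace ℝ (Fin K)) :=
  Submodule.span ℝ (Set.range fun j : Fin L => WithLp.toLp 2 fun i : Fin K => M i j)

/-- The row space of a matrix. -/
def rowSpace {K L : ℕ} (M : Matrix (Fin K) (Fin L) ℝ) : Submodule ℝ (EuclideanSpace ℝ (Fin L)) :=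
  Submodule.span ℝ (Set.range fun i : Fin K => WithLp.toLp 2 fun j : Fin L => M i j)

/-- `M = ∑ k, σ k • u k (v k)ᵀ` is a compact singular value decomposition: the `u k` and the `v k`
are orthonormal systems and all `σ k` are positive (so that `r` is the rank of `M`). -/
structure IsCompactSVD {K L r : ℕ} (M : Matrix (Fin K) (Fin L) ℝ)
    (u : Fin r → EuclideanSpace ℝ (Fin K)) (σ : Fin r → ℝ)
    (v : Fin r → EuclideanSpace ℝ (Fin L)) : Prop where
  orthonormal_left : Orthonormal ℝ u
  orthonormal_right : Orthonormal ℝ v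
  pos : ∀ k, 0 < σ k
  eq_sum : ∀ i j, M i j = ∑ k, σ k * (u k i * v k j)

/-- Assumption A0 with constant `μ₀ > 0`. -/
def ObeysA0 {K L : ℕ} (M : Matrix (Fin K) (Fin L) ℝ) (μ₀ : ℝ) : Prop :=
  0 < μ₀ ∧ max (coherence (colSpace M)) (coherence (rowSpace M)) ≤ μ₀

/-- Assumption A1 with constant `μ₁ > 0`: the largest absolute entry of `∑ k, u k (v k)ᵀ` is at
most `μ₁ √(r / (K L))`. The matrix `∑ k, u k (v k)ᵀ` does not depend on the compact singular value
decomposition; the bound is required for each of them, and that there is one. -/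
def ObeysA1 {K L : ℕ} (M : Matrix (Fin K) (Fin L) ℝ) (μ₁ : ℝ) : Prop :=
  0 < μ₁ ∧
  (∃ (r : ℕ) (u : Fin r → EuclideanSpace ℝ (Fin K)) (σ : Fin r → ℝ)
    (v : Fin r → EuclideanSpace ℝ (Fin L)), IsCompactSVD M u σ v) ∧
  ∀ (r : ℕ) (u : Fin r → EuclideanSpace ℝ (Fin K)) (σ : Fin r → ℝ)
    (v : Fin r → EuclideanSpace ℝ (Fin L)), IsCompactSVD M u σ v →
    ∀ i j, |∑ k, u k i * v k j| ≤ μ₁ * √((r : ℝ) / ((K : ℝ) * (L : ℝ)))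

/-- The `k`-th moment `m_k` of a measure on the real line. -/
def mom (P : Measure ℝ) (k : ℕ) : ℝ := ∫ s, s ^ k ∂P

/-- `ζ = d (m₄ - m₂²) + d² m₂² + 1`. -/
def zeta (P : Measure ℝ) (d : ℕ) : ℝ :=
  (d : ℝ) * (mom P 4 - mom P 2 ^ 2) + (d : ℝ) ^ 2 * mom P 2 ^ 2 + 1

/-- `λ* = min {ζ - √(ζ² - 4 d (m₄ - m₂²)), 2 m₂}`. -/
def lambdaStar (P : Measure ℝ) (d : ℕ) : ℝ :=
  min (zeta P d - √(zeta P d ^ 2 - 4 * (d : ℝ) * (mom P 4 - mom P 2 ^ 2))) (2 * mom P 2)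

/-- `θ = 2 (1 + d a² + d² a⁴) / λ*`. -/
def theta (P : Measure ℝ) (d : ℕ) (a : ℝ) : ℝ :=
  2 * (1 + (d : ℝ) * a ^ 2 + (d : ℝ) ^ 2 * a ^ 4) / lambdaStar P d

end RandomEDM

end

/-! Lift each point `p` to `z = (1, ‖p‖², p)` in dimension `d + 2`. Then `‖p - q‖²` is the dot
product of `z` with the dual lift `(‖q‖², 1, -2q)`, so `Δ = X Yᵀ`, where `X` has the lifts as rows
and `Y` is `X` followed by an invertible linear map. This gives rank at most `d + 2` and places the
column space of `Δ` inside the range of `X`.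

Everything else follows from one estimate, `Xᵀ X ≥ c` with `c > 0`, together with `‖z‖² ≤ B = 1 + d
a² + d² a⁴`. The estimate makes `X` and `Y` injective, so the rank is `d + 2`. If `y = P_U e_i = X
w`, then `‖y‖² = y_i = z_i · w`, and Cauchy–Schwarz gives `‖y‖⁴ ≤ B ‖w‖² ≤ B ‖y‖² / c`, so `‖P_U
e_i‖² ≤ B / c`. That is A0; A1 follows by Bessel and Cauchy–Schwarz (`edm_obeys`).

For one lift, `m₁ = m₃ = 0` splits `E z zᵀ` into `m₂` times the identity on the `p` coordinates and
the block `[[1, q], [q, q² + e]]`, with `q = d m₂` and `e = d (m₄ - m₂²)`. The smaller eigenvalue of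
this block is `(ζ - √(ζ² - 4e)) / 2`, so `E z zᵀ ≥ μ = λ*/2`, which is positive because `P` has no
atoms. Here `θ = B / μ`.

The estimate with `c = t N μ` is the lower tail of matrix Chernoff (`exists_event_le_sum_sq`), with
failure probability below `(d + 2) exp (-(1 - t + t log t) N μ / B)`. Instead of matrix
exponentials, the proof uses traces of `(1 - (σ/n) ∑ z zᵀ) ^ n` for large `n`. Differentiating along
a rank one perturbation shows that a new vector lowers the trace by a multiple of `zᵀ Cⁿ z`; after
averaging, each vector contributes an exponential factor, and Markov's inequality concludes. Finally
`1 - t + t log t > (1 - t)² / 2` turns the assumption on `N` into a failure probability below `γ`.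
-/

namespace RandomEDM

open Matrix Finset

/-! ### Powers of symmetric matrices under rank one perturbations. -/

section Spectral

variable {ι : Type*} [Fintype ι]

/-- A quadratic form in terms of a coordinate expansion of its matrix. -/
lemma dotProduct_mulVec_eq_sum {M : Matrix ι ι ℝ} {c : ι → ℝ} {u : ι → ι → ℝ}
    (hM : ∀ a b, M a b = ∑ i, c i * (u i a * u i b)) (z : ι → ℝ) :
    z ⬝ᵥ M *ᵥ z = ∑ i, c i * (u i ⬝ᵥ z) ^ 2 := by
  simp only [dotProduct, Matrix.mulVec, hM, Finset.sum_mul, Finset.mul_sum]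
  rw [Finset.sum_congr rfl fun a _ => Finset.sum_comm, Finset.sum_comm]
  refine Finset.sum_congr rfl fun i _ => ?_
  rw [sq, Finset.sum_mul_sum, Finset.mul_sum]
  refine Finset.sum_congr rfl fun a _ => ?_
  rw [Finset.mul_sum]
  refine Finset.sum_congr rfl fun b _ => ?_
  ring

variable [DecidableEq ι]

/-- The spectral theorem for a real symmetric matrix and its powers, in coordinates. -/
lemma exists_spectral_pow {C : Matrix ι ι ℝ} (hC : C.IsHermitian) :
    ∃ (l : ι → ℝ) (u : ι → ι → ℝ), (∀ i j, u i ⬝ᵥ u j = if i = j then 1 else 0) ∧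
      (∀ a b, ∑ i, u i a * u i b = if a = b then 1 else 0) ∧
      ∀ k a b, (C ^ k) a b = ∑ i, l i ^ k * (u i a * u i b) := by
  have h1 : ∀ a b, ∑ i, hC.eigenvectorBasis i a * hC.eigenvectorBasis i b
      = if a = b then 1 else 0 := by
    intro a b
    have h := Unitary.mul_star_self_of_mem hC.eigenvectorUnitary.2
    have h2 : ((hC.eigenvectorUnitary : Matrix ι ι ℝ) * star (hC.eigenvectorUnitary : Matrix ι ι ℝ))
        a b = (1 : Matrix ι ι ℝ) a b := by rw [h]
    rw [Matrix.mul_apply, Matrix.one_apply] at h2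
    simpa only [Matrix.star_apply, Matrix.IsHermitian.eigenvectorUnitary_apply,
      star_trivial] using h2
  refine ⟨hC.eigenvalues, fun i a => hC.eigenvectorBasis i a, ?_, h1, ?_⟩
  · intro i j
    have h := orthonormal_iff_ite.1 hC.eigenvectorBasis.orthonormal i j
    rw [← h]
    simp [PiLp.inner_apply, dotProduct, mul_comm]
  · intro k
    induction k with
    | zero => intro a b; simp [Matrix.one_apply, h1]
    | succ k ih =>
      intro a b
      rw [pow_succ', Matrix.mul_apply]
      simp_rw [ih, Finset.mul_sum]
      rw [Finset.sum_comm]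
      refine Finset.sum_congr rfl fun i _ => ?_
      have h := congrFun (hC.mulVec_eigenvectorBasis i) a
      simp only [Matrix.mulVec, dotProduct, Pi.smul_apply, smul_eq_mul] at h
      have : ∀ c, C a c * (hC.eigenvalues i ^ k * (hC.eigenvectorBasis i c *
          hC.eigenvectorBasis i b)) = (C a c * hC.eigenvectorBasis i c) *
          (hC.eigenvalues i ^ k * hC.eigenvectorBasis i b) := fun c => by ring
      simp_rw [this]
      rw [← Finset.sum_mul, h]
      ring

/-- The spectral expansion of a symmetric matrix whose quadratic form lies between `α` and `β`. -/
lemma exists_spectral_pow_of_bounds {C : Matrix ι ι ℝ} (hC : C.IsHermitian) {α β : ℝ}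
    (hlo : ∀ v, α * (v ⬝ᵥ v) ≤ v ⬝ᵥ C *ᵥ v) (hhi : ∀ v, v ⬝ᵥ C *ᵥ v ≤ β * (v ⬝ᵥ v)) :
    ∃ (l : ι → ℝ) (u : ι → ι → ℝ), (∀ i, α ≤ l i ∧ l i ≤ β) ∧ (∀ i, u i ⬝ᵥ u i = 1) ∧
      (∀ v, ∑ i, (u i ⬝ᵥ v) ^ 2 = v ⬝ᵥ v) ∧ (∀ k, (C ^ k).trace = ∑ i, l i ^ k) ∧
      (∀ k a b, (C ^ k) a b = ∑ i, l i ^ k * (u i a * u i b)) ∧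
      ∀ k v, v ⬝ᵥ (C ^ k) *ᵥ v = ∑ i, l i ^ k * (u i ⬝ᵥ v) ^ 2 := by
  obtain ⟨l, u, h1, h2, h3⟩ := exists_spectral_pow hC
  have h4 : ∀ k v, v ⬝ᵥ (C ^ k) *ᵥ v = ∑ i, l i ^ k * (u i ⬝ᵥ v) ^ 2 :=
    fun k v => dotProduct_mulVec_eq_sum (h3 k) v
  have h5 : ∀ i, u i ⬝ᵥ C *ᵥ u i = l i := by
    intro i
    have := h4 1 (u i)
    simpa [h1] using this
  refine ⟨l, u, fun i => ⟨?_, ?_⟩, fun i => by simp [h1], ?_, ?_, h3, h4⟩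
  · simpa [h1, h5] using hlo (u i)
  · simpa [h1, h5] using hhi (u i)
  · intro v
    have := h4 0 v
    simpa using this.symm
  · intro k
    simp only [Matrix.trace, Matrix.diag, h3]
    rw [Finset.sum_comm]
    refine Finset.sum_congr rfl fun i _ => ?_
    rw [← Finset.mul_sum]
    have := h1 i i
    simp only [dotProduct, if_true] at this
    rw [this, mul_one]

/-- Chebyshev's sum inequality for the spectral measure of a vector. -/
lemma quadForm_pow_mul_le {C : Matrix ι ι ℝ} (hC : C.IsHermitian) {α β : ℝ} (hα : 0 ≤ α)
    (hlo : ∀ v, α * (v ⬝ᵥ v) ≤ v ⬝ᵥ C *ᵥ v) (hhi : ∀ v, v ⬝ᵥ C *ᵥ v ≤ β * (v ⬝ᵥ v))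
    (z : ι → ℝ) (j k : ℕ) :
    (z ⬝ᵥ (C ^ j) *ᵥ z) * (z ⬝ᵥ (C ^ k) *ᵥ z) ≤ (z ⬝ᵥ z) * (z ⬝ᵥ (C ^ (j + k)) *ᵥ z) := by
  obtain ⟨l, u, hl, -, h1, -, -, h4⟩ := exists_spectral_pow_of_bounds hC hlo hhi
  rw [h4, h4, h4, ← h1]
  set c := fun i => (u i ⬝ᵥ z) ^ 2
  have hc : ∀ i, 0 ≤ c i := fun i => sq_nonneg _
  have hl0 : ∀ i, 0 ≤ l i := fun i => hα.trans (hl i).1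
  -- On nonnegative eigenvalues both powers are increasing, so their differences have the same sign.
  -- Summing this over pairs, with weights `c a * c b`, gives twice the claim.
  have key : ∀ a b, l a ^ j * l b ^ k + l b ^ j * l a ^ k
      ≤ l a ^ (j + k) + l b ^ (j + k) := by
    intro a b
    have : 0 ≤ (l a ^ j - l b ^ j) * (l a ^ k - l b ^ k) := by
      rcases le_total (l a) (l b) with h | h
      · exact mul_nonneg_of_nonpos_of_nonpos
          (sub_nonpos.2 (pow_le_pow_left₀ (hl0 a) h j)) (sub_nonpos.2 (pow_le_pow_left₀ (hl0 a) h k))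
      · exact mul_nonneg
          (sub_nonneg.2 (pow_le_pow_left₀ (hl0 b) h j)) (sub_nonneg.2 (pow_le_pow_left₀ (hl0 b) h k))
    rw [pow_add, pow_add]; linarith
  have e1 : (∑ i, l i ^ j * c i) * (∑ i, l i ^ k * c i)
      = ∑ a, ∑ b, c a * c b * (l a ^ j * l b ^ k) := by
    rw [Finset.sum_mul_sum]
    exact Finset.sum_congr rfl fun a _ => Finset.sum_congr rfl fun b _ => by ring
  have e2 : (∑ i, l i ^ j * c i) * (∑ i, l i ^ k * c i)
      = ∑ a, ∑ b, c a * c b * (l b ^ j * l a ^ k) := by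
    rw [e1, Finset.sum_comm]
    exact Finset.sum_congr rfl fun a _ => Finset.sum_congr rfl fun b _ => by ring
  have e3 : (∑ i, c i) * (∑ i, l i ^ (j + k) * c i)
      = ∑ a, ∑ b, c a * c b * l b ^ (j + k) := by
    rw [Finset.sum_mul_sum]
    exact Finset.sum_congr rfl fun a _ => Finset.sum_congr rfl fun b _ => by ring
  have e4 : (∑ i, c i) * (∑ i, l i ^ (j + k) * c i)
      = ∑ a, ∑ b, c a * c b * l a ^ (j + k) := by
    rw [e3, Finset.sum_comm]
    exact Finset.sum_congr rfl fun a _ => Finset.sum_congr rfl fun b _ => by ring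
  have e5 : (∑ i, l i ^ j * c i) * (∑ i, l i ^ k * c i)
        + (∑ i, l i ^ j * c i) * (∑ i, l i ^ k * c i)
      ≤ (∑ i, c i) * (∑ i, l i ^ (j + k) * c i) + (∑ i, c i) * (∑ i, l i ^ (j + k) * c i) := by
    conv_lhs => enter [1]; rw [e1]
    conv_lhs => enter [2]; rw [e2]
    conv_rhs => enter [1]; rw [e4]
    conv_rhs => enter [2]; rw [e3]
    simp only [← Finset.sum_add_distrib]
    refine Finset.sum_le_sum fun a _ => Finset.sum_le_sum fun b _ => ?_
    have := mul_le_mul_of_nonneg_left (key a b) (mul_nonneg (hc a) (hc b))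
    linarith
  linarith

/-- Each eigenvalue lies in `[α, β]`, so one more factor of `C` costs at most `β` and at least `α`.
This allows exponents to be shifted by one in the perturbation argument. -/
lemma mul_quadForm_pow_le_succ {C : Matrix ι ι ℝ} (hC : C.IsHermitian) {α β : ℝ} (hα : 0 ≤ α)
    (hlo : ∀ v, α * (v ⬝ᵥ v) ≤ v ⬝ᵥ C *ᵥ v) (hhi : ∀ v, v ⬝ᵥ C *ᵥ v ≤ β * (v ⬝ᵥ v))
    (z : ι → ℝ) (k : ℕ) :
    0 ≤ z ⬝ᵥ (C ^ k) *ᵥ z ∧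
    α * (z ⬝ᵥ (C ^ k) *ᵥ z) ≤ z ⬝ᵥ (C ^ (k + 1)) *ᵥ z ∧
    z ⬝ᵥ (C ^ (k + 1)) *ᵥ z ≤ β * (z ⬝ᵥ (C ^ k) *ᵥ z) := by
  obtain ⟨l, u, hl, -, -, -, -, h4⟩ := exists_spectral_pow_of_bounds hC hlo hhi
  have hl0 : ∀ i, 0 ≤ l i ^ k * (u i ⬝ᵥ z) ^ 2 :=
    fun i => mul_nonneg (pow_nonneg (hα.trans (hl i).1) k) (sq_nonneg _)
  rw [h4, h4, Finset.mul_sum, Finset.mul_sum]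
  refine ⟨Finset.sum_nonneg fun i _ => hl0 i, Finset.sum_le_sum fun i _ => ?_,
    Finset.sum_le_sum fun i _ => ?_⟩
  · have := mul_le_mul_of_nonneg_right (hl i).1 (hl0 i)
    calc _ ≤ _ := this
      _ = _ := by ring
  · have := mul_le_mul_of_nonneg_right (hl i).2 (hl0 i)
    calc _ = _ := by ring
      _ ≤ _ := this

lemma trace_pow_nonneg_of_bounds {C : Matrix ι ι ℝ} (hC : C.IsHermitian) {α β : ℝ} (hα : 0 ≤ α)
    (hlo : ∀ v, α * (v ⬝ᵥ v) ≤ v ⬝ᵥ C *ᵥ v) (hhi : ∀ v, v ⬝ᵥ C *ᵥ v ≤ β * (v ⬝ᵥ v)) (k : ℕ) :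
    0 ≤ (C ^ k).trace := by
  obtain ⟨l, u, hl, -, -, h, -, -⟩ := exists_spectral_pow_of_bounds hC hlo hhi
  rw [h]
  exact Finset.sum_nonneg fun i _ => pow_nonneg (hα.trans (hl i).1) k

/-- The entries of powers of a matrix between `0` and `1` are bounded by `1`. -/
lemma abs_pow_apply_le_one {C : Matrix ι ι ℝ} (hC : C.IsHermitian) {α : ℝ} (hα : 0 ≤ α)
    (hlo : ∀ v, α * (v ⬝ᵥ v) ≤ v ⬝ᵥ C *ᵥ v) (hhi : ∀ v, v ⬝ᵥ C *ᵥ v ≤ 1 * (v ⬝ᵥ v))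
    (k : ℕ) (a b : ι) : |(C ^ k) a b| ≤ 1 := by
  obtain ⟨l, u, hl, -, h1, -, h3, -⟩ := exists_spectral_pow_of_bounds hC hlo hhi
  have hu : ∀ a, ∑ i, u i a ^ 2 = 1 := by
    intro a
    have := h1 (Pi.single a 1)
    simpa using this
  rw [h3]
  calc |∑ i, l i ^ k * (u i a * u i b)| ≤ ∑ i, |l i ^ k * (u i a * u i b)| :=
        Finset.abs_sum_le_sum_abs _ _
    _ ≤ ∑ i, (u i a ^ 2 + u i b ^ 2) / 2 := by
        refine Finset.sum_le_sum fun i _ => ?_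
        have h0 := hα.trans (hl i).1
        rw [abs_mul, abs_of_nonneg (pow_nonneg h0 k)]
        have h5 : l i ^ k ≤ 1 := pow_le_one₀ h0 (hl i).2
        have h6 : |u i a * u i b| ≤ (u i a ^ 2 + u i b ^ 2) / 2 := by
          rw [abs_le]; constructor <;> nlinarith [sq_nonneg (u i a - u i b), sq_nonneg (u i a + u i b)]
        calc _ ≤ 1 * |u i a * u i b| := mul_le_mul_of_nonneg_right h5 (abs_nonneg _)
          _ ≤ _ := by linarith
    _ = 1 := by
        rw [← Finset.sum_div, Finset.sum_add_distrib, hu, hu]; norm_num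

/-- The trace of a power against a form bounded from below. -/
lemma mul_trace_pow_le_sum {C G : Matrix ι ι ℝ} (hC : C.IsHermitian) {α β μ : ℝ} (hα : 0 ≤ α)
    (hlo : ∀ v, α * (v ⬝ᵥ v) ≤ v ⬝ᵥ C *ᵥ v) (hhi : ∀ v, v ⬝ᵥ C *ᵥ v ≤ β * (v ⬝ᵥ v))
    (hG : ∀ v, μ * (v ⬝ᵥ v) ≤ v ⬝ᵥ G *ᵥ v) (k : ℕ) :
    μ * (C ^ k).trace ≤ ∑ a, ∑ b, (C ^ k) a b * G a b := by
  obtain ⟨l, u, hl, hu, h1, h2, h3, -⟩ := exists_spectral_pow_of_bounds hC hlo hhi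
  have e : ∑ a, ∑ b, (C ^ k) a b * G a b = ∑ i, l i ^ k * (u i ⬝ᵥ G *ᵥ u i) := by
    simp only [h3, dotProduct, Matrix.mulVec, Finset.sum_mul, Finset.mul_sum]
    rw [Finset.sum_congr rfl fun a _ => Finset.sum_comm, Finset.sum_comm]
    refine Finset.sum_congr rfl fun i _ => Finset.sum_congr rfl fun a _ =>
      Finset.sum_congr rfl fun b _ => ?_
    ring
  rw [e, h2, Finset.mul_sum]
  refine Finset.sum_le_sum fun i _ => ?_
  have := mul_le_mul_of_nonneg_left (hG (u i)) (pow_nonneg (hα.trans (hl i).1) k)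
  rw [hu] at this
  linarith

/-- If the trace of a power is small then the matrix is small. -/
lemma quadForm_le_of_trace_pow_lt {C : Matrix ι ι ℝ} (hC : C.IsHermitian) {α β b : ℝ} (hα : 0 ≤ α)
    (hlo : ∀ v, α * (v ⬝ᵥ v) ≤ v ⬝ᵥ C *ᵥ v) (hhi : ∀ v, v ⬝ᵥ C *ᵥ v ≤ β * (v ⬝ᵥ v))
    (hb : 0 ≤ b) {k : ℕ} (h : (C ^ k).trace < b ^ k) (v : ι → ℝ) :
    v ⬝ᵥ C *ᵥ v ≤ b * (v ⬝ᵥ v) := by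
  obtain ⟨l, u, hl, hu, h1, h2, h3, h4⟩ := exists_spectral_pow_of_bounds hC hlo hhi
  have hl0 : ∀ i, 0 ≤ l i := fun i => hα.trans (hl i).1
  have hlb : ∀ i, l i ≤ b := by
    intro i
    have : l i ^ k < b ^ k := by
      refine lt_of_le_of_lt ?_ h
      rw [h2]
      exact Finset.single_le_sum (f := fun i => l i ^ k) (fun j _ => pow_nonneg (hl0 j) k)
        (Finset.mem_univ i)
    exact (lt_of_pow_lt_pow_left₀ k hb this).le
  have := h4 1 v
  rw [pow_one] at this
  rw [this, ← h1, Finset.mul_sum]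
  refine Finset.sum_le_sum fun i _ => ?_
  rw [pow_one]
  exact mul_le_mul_of_nonneg_right (hlb i) (sq_nonneg _)

/-- The derivative of the powers of an affine family of matrices. -/
lemma hasDerivAt_pow_apply (C Z : Matrix ι ι ℝ) (n : ℕ) (a b : ι) (r : ℝ) :
    HasDerivAt (fun r : ℝ => ((C + r • Z) ^ n) a b)
      ((∑ i ∈ range n, (C + r • Z) ^ i * Z * (C + r • Z) ^ (n - 1 - i)) a b) r := by
  induction n generalizing a b with
  | zero => simpa using hasDerivAt_const r _
  | succ n ih =>
    have h1 : ∀ c, HasDerivAt (fun r : ℝ => (C + r • Z) c b) (Z c b) r := by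
      intro c
      have := ((hasDerivAt_id r).mul_const (Z c b)).const_add (C c b)
      simpa using this
    have h2 := HasDerivAt.fun_sum (u := univ) fun c _ => (ih a c).mul (h1 c)
    have e : ∑ i ∈ range (n + 1), (C + r • Z) ^ i * Z * (C + r • Z) ^ (n + 1 - 1 - i)
        = (∑ i ∈ range n, (C + r • Z) ^ i * Z * (C + r • Z) ^ (n - 1 - i)) * (C + r • Z)
          + (C + r • Z) ^ n * Z := by
      rw [Finset.sum_range_succ, Finset.sum_mul]
      congr 1
      · refine Finset.sum_congr rfl fun i hi => ?_
        have : n + 1 - 1 - i = (n - 1 - i) + 1 := by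
          have := Finset.mem_range.1 hi; omega
        rw [this, pow_succ _ (n - 1 - i), mul_assoc _ _ (C + r • Z)]
      · simp
    have e2 : (fun r : ℝ => ((C + r • Z) ^ (n + 1)) a b)
        = fun r : ℝ => ∑ c, ((C + r • Z) ^ n) a c * (C + r • Z) c b := by
      funext r
      rw [pow_succ, Matrix.mul_apply]
    rw [e, e2, Matrix.add_apply, Matrix.mul_apply, Matrix.mul_apply, ← Finset.sum_add_distrib]
    exact h2

/-- Cyclicity of the trace makes all `n + 1` terms of the product rule equal, although `C` and `Z`
need not commute. -/
lemma hasDerivAt_trace_pow (C Z : Matrix ι ι ℝ) (n : ℕ) (r : ℝ) :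
    HasDerivAt (fun r : ℝ => ((C + r • Z) ^ (n + 1)).trace)
      ((n + 1) * (Z * (C + r • Z) ^ n).trace) r := by
  have h := HasDerivAt.fun_sum (u := univ) fun a _ => hasDerivAt_pow_apply C Z (n + 1) a a r
  have e : ∑ a, (∑ i ∈ range (n + 1), (C + r • Z) ^ i * Z * (C + r • Z) ^ (n + 1 - 1 - i)) a a
      = (n + 1) * (Z * (C + r • Z) ^ n).trace := by
    have e0 : ∀ M : Matrix ι ι ℝ, ∑ a, M a a = M.trace := fun _ => rfl
    rw [e0, Matrix.trace_sum]
    have : ∀ i ∈ range (n + 1), ((C + r • Z) ^ i * Z * (C + r • Z) ^ (n + 1 - 1 - i)).trace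
        = (Z * (C + r • Z) ^ n).trace := by
      intro i hi
      rw [mul_assoc, Matrix.trace_mul_comm, mul_assoc, ← pow_add]
      congr 3
      have := Finset.mem_range.1 hi; omega
    rw [Finset.sum_congr rfl this]
    simp
  rw [← e]
  exact h

lemma hasDerivAt_quadForm_pow (C Z : Matrix ι ι ℝ) (z : ι → ℝ) (n : ℕ) (r : ℝ) :
    HasDerivAt (fun r : ℝ => z ⬝ᵥ ((C + r • Z) ^ n) *ᵥ z)
      (∑ i ∈ range n, z ⬝ᵥ ((C + r • Z) ^ i * Z * (C + r • Z) ^ (n - 1 - i)) *ᵥ z) r := by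
  have h := HasDerivAt.fun_sum (u := univ) fun a _ => (HasDerivAt.fun_sum (u := univ) fun b _ =>
    (hasDerivAt_pow_apply C Z n a b r).mul_const (z b)).const_mul (z a)
  rw [← dotProduct_sum, ← Matrix.sum_mulVec]
  exact h

/-- A rank one Golden–Thompson inequality for powers: subtracting `h • z zᵀ` from a matrix `C`
between `1 - η` and `1` decreases the trace of its `n`-th power by a definite multiple of the
quadratic form of that power. -/
lemma trace_pow_sub_vecMulVec_le {C : Matrix ι ι ℝ} (hC : C.IsHermitian) {η h B : ℝ}
    (hη : η < 1) (hh : 0 < h) (hB : 0 < B) {z : ι → ℝ} (hz : z ⬝ᵥ z ≤ B)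
    (hlo : ∀ v, (1 - η) * (v ⬝ᵥ v) + h * (z ⬝ᵥ v) ^ 2 ≤ v ⬝ᵥ C *ᵥ v)
    (hhi : ∀ v, v ⬝ᵥ C *ᵥ v ≤ 1 * (v ⬝ᵥ v)) (m : ℕ) :
    ((C - h • vecMulVec z z) ^ (m + 1)).trace ≤ (C ^ (m + 1)).trace
      - (1 - Real.exp (-(h * (m + 1) * B / (1 - η)))) * (1 - η) / B
        * (z ⬝ᵥ (C ^ (m + 1)) *ᵥ z) := by
  set Z : Matrix ι ι ℝ := (-h) • vecMulVec z z with hZ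
  set κ := h * (m + 1) * B / (1 - η) with hκ
  have hη' : 0 < 1 - η := by linarith
  have hκ0 : 0 < κ := by positivity
  have hZq : ∀ v, v ⬝ᵥ Z *ᵥ v = -h * (z ⬝ᵥ v) ^ 2 := by
    intro v
    rw [hZ, smul_mulVec, dotProduct_smul, vecMulVec_mulVec]
    simp only [dotProduct_smul, dotProduct_comm v z, MulOpposite.smul_eq_mul_unop,
      MulOpposite.unop_op, smul_eq_mul]
    ring
  have hCr : ∀ r : ℝ, (C + r • Z).IsHermitian := fun r =>
    hC.add (by ext a b; simp [hZ, vecMulVec_apply, mul_comm])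
  have hq : ∀ (r : ℝ) v, v ⬝ᵥ (C + r • Z) *ᵥ v = v ⬝ᵥ C *ᵥ v - r * h * (z ⬝ᵥ v) ^ 2 := by
    intro r v
    rw [add_mulVec, dotProduct_add, smul_mulVec, dotProduct_smul, hZq, smul_eq_mul]; ring
  have hlo' : ∀ r : ℝ, r ≤ 1 → ∀ v, (1 - η) * (v ⬝ᵥ v) ≤ v ⬝ᵥ (C + r • Z) *ᵥ v := by
    intro r hr v
    rw [hq]
    have := hlo v
    nlinarith [mul_nonneg (mul_nonneg hh.le (sq_nonneg (z ⬝ᵥ v))) (sub_nonneg.2 hr)]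
  have hhi' : ∀ r : ℝ, 0 ≤ r → ∀ v, v ⬝ᵥ (C + r • Z) *ᵥ v ≤ 1 * (v ⬝ᵥ v) := by
    intro r hr v
    rw [hq]
    have := hhi v
    nlinarith [mul_nonneg (mul_nonneg hh.le (sq_nonneg (z ⬝ᵥ v))) hr]
  set f : ℝ → ℝ := fun r => z ⬝ᵥ ((C + r • Z) ^ m) *ᵥ z with hf
  set f' : ℝ → ℝ := fun r =>
    ∑ i ∈ range m, z ⬝ᵥ ((C + r • Z) ^ i * Z * (C + r • Z) ^ (m - 1 - i)) *ᵥ z with hf'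
  have hfd : ∀ r, HasDerivAt f (f' r) r := hasDerivAt_quadForm_pow C Z z m
  have hsymm_pow : ∀ (r : ℝ) (k : ℕ), (C + r • Z) ^ k = ((C + r • Z) ^ k)ᵀ := by
    intro r k
    have := (hCr r).pow k
    rw [Matrix.IsHermitian, conjTranspose_eq_transpose_of_trivial] at this
    exact this.symm
  have hterm : ∀ (r : ℝ) (i j : ℕ), z ⬝ᵥ ((C + r • Z) ^ i * Z * (C + r • Z) ^ j) *ᵥ z
      = -h * ((z ⬝ᵥ ((C + r • Z) ^ i) *ᵥ z) * (z ⬝ᵥ ((C + r • Z) ^ j) *ᵥ z)) := by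
    intro r i j
    have hv : ∀ v, Z *ᵥ v = (-h * (z ⬝ᵥ v)) • z := by
      intro v
      rw [hZ, smul_mulVec, vecMulVec_mulVec, op_smul_eq_smul, smul_smul]
    rw [← mulVec_mulVec, ← mulVec_mulVec, hv, mulVec_smul, dotProduct_smul, smul_eq_mul]
    ring
  -- As `Z` has rank one, each term of `f'` is `-h` times a product of two quadratic forms.
  -- Chebyshev merges them into the power `m - 1`, at the cost of `‖z‖² ≤ B`, and the lower bound `1
  -- - η` raises this to `m`. Enlarging the count `m` to `m + 1` in `κ` makes `h (m + 1) / κ` equal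
  -- to `(1 - η) / B` below.
  have hf'_ge : ∀ r, 0 ≤ r → r ≤ 1 → -κ * f r ≤ f' r := by
    intro r h0 h1
    have hf0 : 0 ≤ f r := (mul_quadForm_pow_le_succ (hCr r) hη'.le (hlo' r h1) (hhi' r h0) z m).1
    rcases Nat.eq_zero_or_pos m with rfl | hm
    · simp only [hf', range_zero, sum_empty]
      nlinarith [mul_nonneg hκ0.le hf0]
    obtain ⟨p, rfl⟩ : ∃ p, m = p + 1 := ⟨m - 1, by omega⟩
    have hp := mul_quadForm_pow_le_succ (hCr r) hη'.le (hlo' r h1) (hhi' r h0) z p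
    set q := z ⬝ᵥ ((C + r • Z) ^ p) *ᵥ z with hqdef
    have hi : ∀ i ∈ range (p + 1), -h * (B * q) ≤
        z ⬝ᵥ ((C + r • Z) ^ i * Z * (C + r • Z) ^ (p + 1 - 1 - i)) *ᵥ z := by
      intro i hi
      rw [hterm]
      have h2 := quadForm_pow_mul_le (hCr r) hη'.le (hlo' r h1) (hhi' r h0) z i (p + 1 - 1 - i)
      have h3 : i + (p + 1 - 1 - i) = p := by have := Finset.mem_range.1 hi; omega
      rw [h3] at h2
      have h4 : z ⬝ᵥ z * q ≤ B * q := mul_le_mul_of_nonneg_right hz hp.1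
      nlinarith [mul_le_mul_of_nonneg_left (h2.trans h4) hh.le]
    have h5 := Finset.card_nsmul_le_sum _ _ _ hi
    rw [Finset.card_range, nsmul_eq_mul] at h5
    refine le_trans ?_ h5
    have h6 : q ≤ f r / (1 - η) := by
      rw [le_div_iff₀ hη']; linarith [hp.2.1]
    have h7 : h * B * q * (p + 1) ≤ κ * f r := by
      have : κ * f r = h * B * (f r / (1 - η)) * ((p + 1 : ℕ) + 1) := by
        rw [hκ]; field_simp
      rw [this]
      push_cast
      have h8 : 0 ≤ f r / (1 - η) := by positivity
      have h9 : h * B * q ≤ h * B * (f r / (1 - η)) :=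
        mul_le_mul_of_nonneg_left h6 (by positivity)
      have h10 : 0 ≤ h * B * (f r / (1 - η)) := by positivity
      nlinarith [mul_le_mul_of_nonneg_right h9 (by positivity : (0:ℝ) ≤ p + 1)]
    push_cast
    nlinarith
  -- Grönwall with an integrating factor: `f` decays no faster than `exp (-κ r)`.
  have hmono : MonotoneOn (fun r => Real.exp (κ * r) * f r) (Set.Icc 0 1) := by
    have hd : ∀ r, HasDerivAt (fun r => Real.exp (κ * r) * f r)
        (Real.exp (κ * r) * κ * f r + Real.exp (κ * r) * f' r) r := by
      intro r
      have h1 : HasDerivAt (fun r => Real.exp (κ * r)) (Real.exp (κ * r) * κ) r := by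
        simpa using ((hasDerivAt_id r).const_mul κ).exp
      exact h1.mul (hfd r)
    refine monotoneOn_of_deriv_nonneg (convex_Icc 0 1)
      (fun r _ => (hd r).continuousAt.continuousWithinAt)
      (fun r _ => (hd r).differentiableAt.differentiableWithinAt) fun r hr => ?_
    rw [interior_Icc] at hr
    rw [(hd r).deriv]
    nlinarith [mul_le_mul_of_nonneg_left (hf'_ge r hr.1.le hr.2.le) (Real.exp_pos (κ * r)).le]
  have hfr : ∀ r ∈ Set.Icc (0 : ℝ) 1, f 0 * Real.exp (-(κ * r)) ≤ f r := by
    intro r hr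
    have h1 := hmono (Set.left_mem_Icc.2 zero_le_one) hr hr.1
    simp only [mul_zero, Real.exp_zero, one_mul] at h1
    rw [Real.exp_neg, ← div_eq_mul_inv, div_le_iff₀ (Real.exp_pos _)]
    linarith
  set φ : ℝ → ℝ := fun r => ((C + r • Z) ^ (m + 1)).trace with hφ
  have hφd : ∀ r, HasDerivAt φ (-(h * (m + 1) * f r)) r := by
    intro r
    have h1 := hasDerivAt_trace_pow C Z m r
    convert h1 using 1
    rw [hZ, smul_mul_assoc, trace_smul, vecMulVec_mul, trace_vecMulVec, ← hZ]
    have : z ᵥ* (C + r • Z) ^ m = (C + r • Z) ^ m *ᵥ z := by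
      conv_rhs => rw [hsymm_pow r m]
      rw [mulVec_transpose]
    rw [this, smul_eq_mul]
    ring
  -- The bound `φ' ≤ -h (m + 1) f 0 exp (-κ r)` is integrated by subtracting an antiderivative of
  -- its right side.
  have hanti : AntitoneOn (fun r => φ r - h * (m + 1) * f 0 / κ * Real.exp (-(κ * r)))
      (Set.Icc 0 1) := by
    have hd : ∀ r, HasDerivAt (fun r => φ r - h * (m + 1) * f 0 / κ * Real.exp (-(κ * r)))
        (-(h * (m + 1) * f r) - h * (m + 1) * f 0 / κ * (Real.exp (-(κ * r)) * (-κ))) r := by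
      intro r
      have h1 : HasDerivAt (fun r => Real.exp (-(κ * r))) (Real.exp (-(κ * r)) * (-κ)) r := by
        simpa using ((hasDerivAt_id r).const_mul κ).neg.exp
      exact (hφd r).sub (h1.const_mul _)
    refine antitoneOn_of_deriv_nonpos (convex_Icc 0 1)
      (fun r _ => (hd r).continuousAt.continuousWithinAt)
      (fun r _ => (hd r).differentiableAt.differentiableWithinAt) fun r hr => ?_
    rw [interior_Icc] at hr
    rw [(hd r).deriv]
    have e : h * (m + 1) * f 0 / κ * (Real.exp (-(κ * r)) * (-κ))
        = -(h * (m + 1) * (f 0 * Real.exp (-(κ * r)))) := by field_simp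
    rw [e]
    have := mul_le_mul_of_nonneg_left (hfr r ⟨hr.1.le, hr.2.le⟩)
      (by positivity : 0 ≤ h * ((m : ℝ) + 1))
    linarith
  have h1 := hanti (Set.left_mem_Icc.2 zero_le_one) (Set.right_mem_Icc.2 zero_le_one) zero_le_one
  simp only [hφ, hf, mul_zero, mul_one, neg_zero, Real.exp_zero, zero_smul, add_zero,
    one_smul] at h1
  have e1 : C + Z = C - h • vecMulVec z z := by rw [hZ, neg_smul, sub_eq_add_neg]
  rw [e1] at h1
  have e2 : ∀ y : ℝ, h * (m + 1) * y / κ = (1 - η) / B * y := by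
    intro y; rw [hκ]; field_simp
  rw [e2] at h1
  -- The decrease must involve the same power as the trace, so that the estimate can be iterated in
  -- expectation.
  have hlast : z ⬝ᵥ (C ^ (m + 1)) *ᵥ z ≤ 1 * (z ⬝ᵥ (C ^ m) *ᵥ z) := by
    have := (mul_quadForm_pow_le_succ (hCr 0) hη'.le (hlo' 0 zero_le_one) (hhi' 0 le_rfl) z m).2.2
    simpa using this
  have hexp : Real.exp (-κ) ≤ 1 := Real.exp_le_one_iff.2 (by linarith)
  have := mul_le_mul_of_nonneg_left hlast
    (by have := sub_nonneg.2 hexp; positivity : 0 ≤ (1 - Real.exp (-κ)) * (1 - η) / B)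
  have e3 : (1 - Real.exp (-κ)) * (1 - η) / B * (1 * (z ⬝ᵥ (C ^ m) *ᵥ z))
      = (1 - η) / B * (z ⬝ᵥ (C ^ m) *ᵥ z) - (1 - η) / B * (z ⬝ᵥ (C ^ m) *ᵥ z) * Real.exp (-κ) := by
    ring
  linarith

end Spectral

/-! ### Matrix Chernoff lower tail. -/

section Chernoff

/-- The matrix `1 - h ∑ j, z j (z j)ᵀ`. -/
def oneSubGram {ι : Type*} [DecidableEq ι] {J : Type*} [Fintype J] (h : ℝ) (z : J → ι → ℝ) : Matrix ι ι ℝ :=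
  1 - h • ∑ j, vecMulVec (z j) (z j)

lemma oneSubGram_isHermitian {ι : Type*} [DecidableEq ι] {J : Type*} [Fintype J]
    (h : ℝ) (z : J → ι → ℝ) : (oneSubGram h z).IsHermitian := by
  ext a b
  simp [oneSubGram, Matrix.sum_apply, vecMulVec_apply, Matrix.one_apply, eq_comm, mul_comm]

variable {ι : Type*} [Fintype ι]

lemma sq_dotProduct_le (u v : ι → ℝ) : (u ⬝ᵥ v) ^ 2 ≤ (u ⬝ᵥ u) * (v ⬝ᵥ v) := by
  simp only [dotProduct, ← sq]
  exact Finset.sum_mul_sq_le_sq_mul_sq _ _ _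

lemma abs_mul_apply_le {z : ι → ℝ} {B : ℝ} (hz : z ⬝ᵥ z ≤ B) (a b : ι) : |z a * z b| ≤ B := by
  have h : ∀ a, z a ^ 2 ≤ B := fun a => by
    refine le_trans ?_ hz
    rw [sq]
    exact Finset.single_le_sum (f := fun i => z i * z i) (fun i _ => mul_self_nonneg _)
      (Finset.mem_univ a)
  rw [abs_le]
  constructor <;>
    nlinarith [h a, h b, sq_nonneg (z a - z b), sq_nonneg (z a + z b)]

variable [DecidableEq ι]

variable {J : Type*} [Fintype J]

lemma oneSubGram_quadForm (h : ℝ) (z : J → ι → ℝ) (v : ι → ℝ) :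
    v ⬝ᵥ oneSubGram h z *ᵥ v = v ⬝ᵥ v - h * ∑ j, (z j ⬝ᵥ v) ^ 2 := by
  rw [oneSubGram, sub_mulVec, one_mulVec, dotProduct_sub, smul_mulVec, dotProduct_smul,
    sum_mulVec, dotProduct_sum, smul_eq_mul]
  congr 2
  refine Finset.sum_congr rfl fun j _ => ?_
  rw [vecMulVec_mulVec, op_smul_eq_smul, dotProduct_smul, smul_eq_mul, dotProduct_comm v, sq]

lemma continuous_oneSubGram_pow (h : ℝ) (n : ℕ) :
    Continuous fun z : J → ι → ℝ => oneSubGram h z ^ n := by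
  unfold oneSubGram
  have : ∀ j, Continuous fun z : J → ι → ℝ => vecMulVec (z j) (z j) := fun j =>
    Continuous.matrix_vecMulVec (continuous_apply j) (continuous_apply j)
  exact (continuous_const.sub ((continuous_finsetSum _ fun j _ => this j).const_smul h)).pow n

lemma oneSubGram_quadForm_le {h : ℝ} (hh : 0 ≤ h) (z : J → ι → ℝ) (v : ι → ℝ) :
    v ⬝ᵥ oneSubGram h z *ᵥ v ≤ 1 * (v ⬝ᵥ v) := by
  rw [oneSubGram_quadForm, one_mul]
  have : 0 ≤ h * ∑ j, (z j ⬝ᵥ v) ^ 2 := mul_nonneg hh (Finset.sum_nonneg fun j _ => sq_nonneg _)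
  linarith

/-- By Cauchy–Schwarz each rank one term is at most `B`. Thus for small `h` the matrix stays
positive, as the trace estimates require. -/
lemma le_oneSubGram_quadForm {h B : ℝ} (hh : 0 ≤ h) {z : J → ι → ℝ}
    (hz : ∀ j, z j ⬝ᵥ z j ≤ B) (v : ι → ℝ) :
    (1 - h * Fintype.card J * B) * (v ⬝ᵥ v) ≤ v ⬝ᵥ oneSubGram h z *ᵥ v := by
  rw [oneSubGram_quadForm]
  have h0 : 0 ≤ v ⬝ᵥ v := Finset.sum_nonneg fun i _ => mul_self_nonneg _
  have h1 : ∑ j, (z j ⬝ᵥ v) ^ 2 ≤ Fintype.card J * (B * (v ⬝ᵥ v)) := by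
    have := Finset.sum_le_card_nsmul univ (fun j => (z j ⬝ᵥ v) ^ 2) (B * (v ⬝ᵥ v)) fun j _ =>
      (sq_dotProduct_le _ _).trans (mul_le_mul_of_nonneg_right (hz j) h0)
    simpa using this
  nlinarith [mul_le_mul_of_nonneg_left h1 hh]

variable {Ω : Type*} [MeasurableSpace Ω] {Pr : Measure Ω}

lemma aestronglyMeasurable_oneSubGram_pow {Z : J → Ω → ι → ℝ} (hZ : ∀ j, Measurable (Z j))
    (h : ℝ) (n : ℕ) (a b : ι) :
    AEStronglyMeasurable (fun ω => (oneSubGram h (fun j => Z j ω) ^ n) a b) Pr := by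
  have h1 : Measurable fun z : J → ι → ℝ => (oneSubGram h z ^ n) a b :=
    ((continuous_oneSubGram_pow h n).matrix_elem a b).measurable
  exact (h1.comp (measurable_pi_lambda _ hZ)).aestronglyMeasurable

variable [IsProbabilityMeasure Pr]

lemma integrable_oneSubGram_pow {Z : J → Ω → ι → ℝ} (hZ : ∀ j, Measurable (Z j))
    {h B : ℝ} (hh : 0 ≤ h) (hη : h * Fintype.card J * B < 1)
    (hB : ∀ᵐ ω ∂Pr, ∀ j, Z j ω ⬝ᵥ Z j ω ≤ B) (n : ℕ) (a b : ι) :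
    Integrable (fun ω => (oneSubGram h (fun j => Z j ω) ^ n) a b) Pr := by
  refine Integrable.of_bound (aestronglyMeasurable_oneSubGram_pow hZ h n a b) 1 ?_
  filter_upwards [hB] with ω hω
  exact abs_pow_apply_le_one (oneSubGram_isHermitian h _) (sub_nonneg.2 hη.le)
    (le_oneSubGram_quadForm hh hω) (oneSubGram_quadForm_le hh _) n a b

/-- Adding one more independent vector contracts the expected trace. -/
lemma integral_trace_oneSubGram_insert_le [DecidableEq J] {Z : J → Ω → ι → ℝ}
    (hZ : ∀ j, Measurable (Z j)) {h B μ : ℝ} (hh : 0 < h) (hB0 : 0 < B)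
    (hη : h * Fintype.card J * B < 1) (hB : ∀ᵐ ω ∂Pr, ∀ j, Z j ω ⬝ᵥ Z j ω ≤ B) (m : ℕ)
    {s : Finset J} {i : J} (hi : i ∉ s)
    (hind : IndepFun (fun ω (j : s) => Z j ω) (Z i) Pr)
    (hμ : ∀ v, μ * (v ⬝ᵥ v) ≤ ∫ ω, (Z i ω ⬝ᵥ v) ^ 2 ∂Pr) :
    ∫ ω, (oneSubGram h (fun j : (insert i s : Finset J) => Z j ω) ^ (m + 1)).trace ∂Pr ≤
      Real.exp (-((1 - Real.exp (-(h * (m + 1) * B / (1 - h * Fintype.card J * B)))) *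
          (1 - h * Fintype.card J * B) / B * μ)) *
      ∫ ω, (oneSubGram h (fun j : s => Z j ω) ^ (m + 1)).trace ∂Pr := by
  set η := h * Fintype.card J * B with hηdef
  set c := (1 - Real.exp (-(h * (m + 1) * B / (1 - η)))) * (1 - η) / B with hc
  have hη' : 0 < 1 - η := by linarith
  have hc0 : 0 ≤ c := by
    have : Real.exp (-(h * (m + 1) * B / (1 - η))) ≤ 1 :=
      Real.exp_le_one_iff.2 (by rw [neg_nonpos]; positivity)
    have := sub_nonneg.2 this
    positivity
  have hcard : ∀ t : Finset J, h * Fintype.card t * B ≤ η := by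
    intro t
    have : (Fintype.card t : ℝ) ≤ Fintype.card J := by
      simpa using Finset.card_le_univ t
    exact mul_le_mul_of_nonneg_right (mul_le_mul_of_nonneg_left this hh.le) hB0.le
  have hint : ∀ (t : Finset J) a b,
      Integrable (fun ω => (oneSubGram h (fun j : t => Z j ω) ^ (m + 1)) a b) Pr := by
    intro t a b
    have hBt : ∀ᵐ ω ∂Pr, ∀ j : t, Z j ω ⬝ᵥ Z j ω ≤ B := by
      filter_upwards [hB] with ω hω j using hω j
    exact integrable_oneSubGram_pow (Z := fun j : t => Z j) (B := B) (fun j => hZ j) hh.le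
      ((hcard t).trans_lt hη) hBt _ a b
  have hint_tr : ∀ t : Finset J,
      Integrable (fun ω => (oneSubGram h (fun j : t => Z j ω) ^ (m + 1)).trace) Pr := fun t =>
    integrable_finsetSum _ fun a _ => hint t a a
  set M : Ω → Matrix ι ι ℝ := fun ω => oneSubGram h (fun j : s => Z j ω) ^ (m + 1) with hM
  set G : Matrix ι ι ℝ := fun a b => ∫ ω, Z i ω a * Z i ω b ∂Pr with hG
  have hZa : ∀ a, Measurable fun ω => Z i ω a := fun a => (measurable_pi_apply a).comp (hZ i)
  have hintZ : ∀ a b, Integrable (fun ω => Z i ω a * Z i ω b) Pr := by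
    intro a b
    refine Integrable.of_bound ((hZa a).mul (hZa b)).aestronglyMeasurable B ?_
    filter_upwards [hB] with ω hω
    exact abs_mul_apply_le (hω i) a b
  have hindab : ∀ a b, IndepFun (fun ω => M ω a b) (fun ω => Z i ω a * Z i ω b) Pr := by
    intro a b
    have h1 : Measurable fun z : s → ι → ℝ => (oneSubGram h z ^ (m + 1)) a b :=
      ((continuous_oneSubGram_pow h (m + 1)).matrix_elem a b).measurable
    have h2 : Measurable fun z : ι → ℝ => z a * z b :=
      (measurable_pi_apply a).mul (measurable_pi_apply b)
    exact hind.comp h1 h2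
  have hprod : ∀ a b, Integrable (fun ω => M ω a b * (Z i ω a * Z i ω b)) Pr := fun a b =>
    (hindab a b).integrable_mul (hint s a b) (hintZ a b)
  have hprod_eq : ∀ a b, ∫ ω, M ω a b * (Z i ω a * Z i ω b) ∂Pr = (∫ ω, M ω a b ∂Pr) * G a b :=
    fun a b => (hindab a b).integral_fun_mul_eq_mul_integral (hint s a b).1 (hintZ a b).1
  have hquad : ∀ ω, Z i ω ⬝ᵥ M ω *ᵥ Z i ω = ∑ a, ∑ b, M ω a b * (Z i ω a * Z i ω b) := by
    intro ω
    simp only [dotProduct, mulVec, Finset.mul_sum]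
    exact Finset.sum_congr rfl fun a _ => Finset.sum_congr rfl fun b _ => by ring
  have hGq : ∀ v, μ * (v ⬝ᵥ v) ≤ v ⬝ᵥ G *ᵥ v := by
    intro v
    refine (hμ v).trans_eq ?_
    have e1 : ∀ ω, (Z i ω ⬝ᵥ v) ^ 2 = ∑ a, ∑ b, v a * v b * (Z i ω a * Z i ω b) := by
      intro ω
      rw [sq, dotProduct, Finset.sum_mul_sum]
      exact Finset.sum_congr rfl fun a _ => Finset.sum_congr rfl fun b _ => by ring
    simp_rw [e1]
    rw [integral_finsetSum _ fun a _ => integrable_finsetSum _ fun b _ => (hintZ a b).const_mul _]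
    simp only [dotProduct, mulVec, Finset.mul_sum]
    refine Finset.sum_congr rfl fun a _ => ?_
    rw [integral_finsetSum _ fun b _ => (hintZ a b).const_mul _]
    refine Finset.sum_congr rfl fun b _ => ?_
    rw [integral_const_mul]
    ring
  have hbounds : ∀ ω, (∀ j, Z j ω ⬝ᵥ Z j ω ≤ B) → ∀ t : Finset J, ∀ v : ι → ℝ,
      (1 - η) * (v ⬝ᵥ v) ≤ v ⬝ᵥ oneSubGram h (fun j : t => Z j ω) *ᵥ v := by
    intro ω hω t v
    refine le_trans ?_ (le_oneSubGram_quadForm (B := B) hh.le (fun j : t => hω j) v)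
    have h0 : 0 ≤ v ⬝ᵥ v := Finset.sum_nonneg fun i _ => mul_self_nonneg _
    exact mul_le_mul_of_nonneg_right (by linarith [hcard t]) h0
  have hinsert : ∀ ω, oneSubGram h (fun j : (insert i s : Finset J) => Z j ω)
      = oneSubGram h (fun j : s => Z j ω) - h • vecMulVec (Z i ω) (Z i ω) := by
    intro ω
    unfold oneSubGram
    rw [Finset.sum_coe_sort (insert i s) (fun j => vecMulVec (Z j ω) (Z j ω)),
      Finset.sum_coe_sort s (fun j => vecMulVec (Z j ω) (Z j ω)), Finset.sum_insert hi, smul_add]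
    abel
  have hstep : ∀ᵐ ω ∂Pr, (oneSubGram h (fun j : (insert i s : Finset J) => Z j ω) ^ (m + 1)).trace
      ≤ (M ω).trace - c * ∑ a, ∑ b, M ω a b * (Z i ω a * Z i ω b) := by
    filter_upwards [hB] with ω hω
    rw [hinsert, ← hquad]
    refine trace_pow_sub_vecMulVec_le (oneSubGram_isHermitian h _) hη hh hB0 (hω i) ?_
      (oneSubGram_quadForm_le hh.le _) m
    intro v
    -- The bound for the enlarged family leaves the room `h (z ⬝ᵥ v) ^ 2` that the rank one step
    -- needs.
    have h1 := hbounds ω hω (insert i s) v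
    rw [oneSubGram_quadForm,
      Finset.sum_coe_sort (insert i s) (fun j => (Z j ω ⬝ᵥ v) ^ 2), Finset.sum_insert hi] at h1
    rw [oneSubGram_quadForm, Finset.sum_coe_sort s (fun j => (Z j ω ⬝ᵥ v) ^ 2)]
    linarith
  -- Independence replaces `z zᵀ` by its mean `G ≥ μ`; pairing `G` with the positive matrix `M ω`
  -- then gives at least `μ` times the trace.
  have hGM : μ * ∫ ω, (M ω).trace ∂Pr ≤ ∑ a, ∑ b, (∫ ω, M ω a b ∂Pr) * G a b := by
    have e : ∑ a, ∑ b, (∫ ω, M ω a b ∂Pr) * G a b = ∫ ω, ∑ a, ∑ b, M ω a b * G a b ∂Pr := by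
      rw [integral_finsetSum _ fun a _ => integrable_finsetSum _ fun b _ => (hint s a b).mul_const _]
      refine Finset.sum_congr rfl fun a _ => ?_
      rw [integral_finsetSum _ fun b _ => (hint s a b).mul_const _]
      exact Finset.sum_congr rfl fun b _ => (integral_mul_const _ _).symm
    rw [e, ← integral_const_mul]
    refine integral_mono_ae ((hint_tr s).const_mul _) (integrable_finsetSum _ fun a _ =>
      integrable_finsetSum _ fun b _ => (hint s a b).mul_const _) ?_
    filter_upwards [hB] with ω hω
    exact mul_trace_pow_le_sum (oneSubGram_isHermitian h _) hη'.le (hbounds ω hω s)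
      (oneSubGram_quadForm_le hh.le _) hGq (m + 1)
  have hnonneg : 0 ≤ ∫ ω, (M ω).trace ∂Pr := by
    refine integral_nonneg_of_ae ?_
    filter_upwards [hB] with ω hω
    exact trace_pow_nonneg_of_bounds (oneSubGram_isHermitian h _) hη'.le (hbounds ω hω s)
      (oneSubGram_quadForm_le hh.le _) (m + 1)
  have hsum_int : Integrable (fun ω => ∑ a, ∑ b, M ω a b * (Z i ω a * Z i ω b)) Pr :=
    integrable_finsetSum _ fun a _ => integrable_finsetSum _ fun b _ => hprod a b
  calc _ ≤ ∫ ω, ((M ω).trace - c * ∑ a, ∑ b, M ω a b * (Z i ω a * Z i ω b)) ∂Pr :=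
        integral_mono_ae (hint_tr _) ((hint_tr s).sub (hsum_int.const_mul c)) hstep
    _ = (∫ ω, (M ω).trace ∂Pr) - c * ∑ a, ∑ b, (∫ ω, M ω a b ∂Pr) * G a b := by
        rw [integral_sub (hint_tr s) (hsum_int.const_mul c), integral_const_mul,
          integral_finsetSum _ fun a _ => integrable_finsetSum _ fun b _ => hprod a b]
        congr 2
        refine Finset.sum_congr rfl fun a _ => ?_
        rw [integral_finsetSum _ fun b _ => hprod a b]
        exact Finset.sum_congr rfl fun b _ => hprod_eq a b
    _ ≤ (1 - c * μ) * ∫ ω, (M ω).trace ∂Pr := by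
        have := mul_le_mul_of_nonneg_left hGM hc0
        linarith
    _ ≤ _ := by
        refine mul_le_mul_of_nonneg_right ?_ hnonneg
        have := Real.add_one_le_exp (-(c * μ))
        linarith

/-- The vectors are added one at a time, starting from the trace of the identity. The constant uses
the full cardinality of `J`, so the contraction factor is the same at each step. -/
lemma integral_trace_oneSubGram_le [DecidableEq J] {Z : J → Ω → ι → ℝ}
    (hZ : ∀ j, Measurable (Z j)) {h B μ : ℝ} (hh : 0 < h) (hB0 : 0 < B)
    (hη : h * Fintype.card J * B < 1) (hB : ∀ᵐ ω ∂Pr, ∀ j, Z j ω ⬝ᵥ Z j ω ≤ B) (m : ℕ)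
    (hind : ∀ (s : Finset J), ∀ i ∉ s, IndepFun (fun ω (j : s) => Z j ω) (Z i) Pr)
    (hμ : ∀ i v, μ * (v ⬝ᵥ v) ≤ ∫ ω, (Z i ω ⬝ᵥ v) ^ 2 ∂Pr) :
    ∫ ω, (oneSubGram h (fun j => Z j ω) ^ (m + 1)).trace ∂Pr ≤
      Fintype.card ι *
      Real.exp (-((1 - Real.exp (-(h * (m + 1) * B / (1 - h * Fintype.card J * B)))) *
          (1 - h * Fintype.card J * B) / B * μ) * Fintype.card J) := by
  set c := (1 - Real.exp (-(h * (m + 1) * B / (1 - h * Fintype.card J * B)))) *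
          (1 - h * Fintype.card J * B) / B * μ with hc
  have key : ∀ s : Finset J,
      ∫ ω, (oneSubGram h (fun j : s => Z j ω) ^ (m + 1)).trace ∂Pr ≤
        Fintype.card ι * Real.exp (-c * s.card) := by
    intro s
    induction s using Finset.induction_on with
    | empty => simp [oneSubGram]
    | insert i s hi ih =>
      refine (integral_trace_oneSubGram_insert_le hZ hh hB0 hη hB m hi (hind s i hi) (hμ i)).trans ?_
      rw [← hc]
      refine (mul_le_mul_of_nonneg_left ih (Real.exp_pos _).le).trans_eq ?_
      rw [Finset.card_insert_of_notMem hi, mul_left_comm, ← Real.exp_add]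
      congr 2
      push_cast
      ring
  have h1 := key univ
  have e : ∀ ω, oneSubGram h (fun j : (univ : Finset J) => Z j ω)
      = oneSubGram h (fun j => Z j ω) := by
    intro ω
    unfold oneSubGram
    rw [Finset.sum_coe_sort univ (fun j => vecMulVec (Z j ω) (Z j ω))]
  simp_rw [e] at h1
  simpa using h1

open Filter Topology in
/-- The lower tail of the matrix Chernoff inequality for sums of independent rank one matrices. -/
theorem exists_event_le_sum_sq [DecidableEq J] {Z : J → Ω → ι → ℝ}
    (hZ : ∀ j, Measurable (Z j)) {B μ t γ : ℝ} (hB0 : 0 < B) (ht : t ∈ Set.Ioo (0 : ℝ) 1)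
    (hB : ∀ᵐ ω ∂Pr, ∀ j, Z j ω ⬝ᵥ Z j ω ≤ B)
    (hind : ∀ (s : Finset J), ∀ i ∉ s, IndepFun (fun ω (j : s) => Z j ω) (Z i) Pr)
    (hμ : ∀ i v, μ * (v ⬝ᵥ v) ≤ ∫ ω, (Z i ω ⬝ᵥ v) ^ 2 ∂Pr)
    (hγ : Fintype.card ι * Real.exp (-(1 - t + t * Real.log t) * (Fintype.card J * μ / B)) < γ) :
    ∃ E : Set Ω, MeasurableSet E ∧ 1 - γ ≤ Pr.real E ∧ ∀ ω ∈ E,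
      (∀ j, Z j ω ⬝ᵥ Z j ω ≤ B) ∧
      ∀ v : ι → ℝ, t * Fintype.card J * μ * (v ⬝ᵥ v) ≤ ∑ j, (Z j ω ⬝ᵥ v) ^ 2 := by
  set N : ℝ := (Fintype.card J : ℝ) with hN
  -- Chosen so that `exp (-σ B) = t`, which yields the Chernoff exponent `1 - t + t log t` in the
  -- limit.
  set σ := -Real.log t / B with hσ
  have hσ0 : 0 < σ := div_pos (neg_pos.2 (Real.log_neg ht.1 ht.2)) hB0
  set x := σ * t * N * μ with hx
  set η : ℕ → ℝ := fun n => σ / n * N * B with hη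
  set c : ℕ → ℝ := fun n => (1 - Real.exp (-(σ * B / (1 - η n)))) * (1 - η n) / B * μ with hc
  have hηlim : Tendsto η atTop (𝓝 0) := by
    have := ((tendsto_const_div_atTop_nhds_zero_nat σ).mul_const N).mul_const B
    simpa using this
  have h1η : Tendsto (fun n => 1 - η n) atTop (𝓝 1) := by simpa using hηlim.const_sub 1
  have hclim : Tendsto c atTop (𝓝 ((1 - t) / B * μ)) := by
    have h1 : Tendsto (fun n => Real.exp (-(σ * B / (1 - η n)))) atTop (𝓝 t) := by
      have h2 := (Real.continuous_exp.tendsto _).comp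
        ((tendsto_const_nhds (x := σ * B)).div h1η one_ne_zero).neg
      have e : Real.exp (-(σ * B / 1)) = t := by
        rw [hσ, div_one, div_mul_cancel₀ _ hB0.ne', neg_neg, Real.exp_log ht.1]
      rw [e] at h2
      exact h2
    have := (((h1.const_sub 1).mul h1η).div_const B).mul_const μ
    simpa using this
  have hL : Tendsto (fun n => Fintype.card ι * Real.exp (-(c n) * N)) atTop
      (𝓝 (Fintype.card ι * Real.exp (-((1 - t) / B * μ) * N))) :=
    ((Real.continuous_exp.tendsto _).comp (hclim.neg.mul_const N)).const_mul _
  have hR : Tendsto (fun n : ℕ => γ * (1 + -x / n) ^ n) atTop (𝓝 (γ * Real.exp (-x))) :=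
    (Real.tendsto_one_add_div_pow_exp (-x)).const_mul γ
  -- The strict inequality assumed for `γ` passes to the limits of both sides, hence holds at some
  -- finite `n`.
  have hlt : Fintype.card ι * Real.exp (-((1 - t) / B * μ) * N) < γ * Real.exp (-x) := by
    have h1 := mul_lt_mul_of_pos_right hγ (Real.exp_pos (-x))
    refine lt_of_le_of_lt (le_of_eq ?_) h1
    rw [mul_assoc, ← Real.exp_add]
    congr 2
    rw [hx, hσ]
    field_simp
    ring
  have hb : Tendsto (fun n : ℕ => 1 + -x / n) atTop (𝓝 1) := by
    simpa using (tendsto_const_div_atTop_nhds_zero_nat (-x)).const_add 1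
  obtain ⟨n, h1, h2, h3, h4⟩ := ((hL.eventually_lt hR hlt).and
    ((hηlim.eventually_lt_const zero_lt_one).and ((hb.eventually_const_lt zero_lt_one).and
      (eventually_ge_atTop 1)))).exists
  obtain ⟨m, rfl⟩ : ∃ m, n = m + 1 := ⟨n - 1, by omega⟩
  set h := σ / ((m + 1 : ℕ) : ℝ) with hh
  have hh0 : 0 < h := by positivity
  set b := 1 + -x / ((m + 1 : ℕ) : ℝ) with hbdef
  have hbh : b = 1 - h * (t * N * μ) := by
    rw [hbdef, hx, hh]; ring
  have hhm : h * (m + 1) = σ := by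
    rw [hh]; push_cast; field_simp
  set f : Ω → ℝ := fun ω => (oneSubGram h (fun j => Z j ω) ^ (m + 1)).trace with hf
  have hfmeas : Measurable f := by
    have h5 : Measurable fun z : J → ι → ℝ => (oneSubGram h z ^ (m + 1)).trace :=
      (continuous_oneSubGram_pow h (m + 1)).matrix_trace.measurable
    exact h5.comp (measurable_pi_lambda _ hZ)
  have hfint : Integrable f Pr := integrable_finsetSum _ fun a _ =>
    integrable_oneSubGram_pow hZ hh0.le h2 hB _ a a
  have hf0 : 0 ≤ᵐ[Pr] f := by
    filter_upwards [hB] with ω hω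
    exact trace_pow_nonneg_of_bounds (oneSubGram_isHermitian h _) (sub_nonneg.2 h2.le)
      (le_oneSubGram_quadForm hh0.le hω) (oneSubGram_quadForm_le hh0.le _) (m + 1)
  have hfle : ∫ ω, f ω ∂Pr < γ * b ^ (m + 1) := by
    have h5 := integral_trace_oneSubGram_le (Pr := Pr) hZ hh0 hB0 h2 hB m hind hμ
    rw [hhm] at h5
    exact h5.trans_lt h1
  -- If the trace of the power is below `b ^ (m + 1)`, all eigenvalues are below `b = 1 - h t N μ`,
  -- that is, the Gram sum is at least `t N μ`.
  have hmarkov := mul_meas_ge_le_integral_of_nonneg hf0 hfint (b ^ (m + 1))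
  have hbp : 0 < b ^ (m + 1) := pow_pos h3 _
  have hbad : Pr.real {ω | b ^ (m + 1) ≤ f ω} < γ := by
    have := hmarkov.trans_lt hfle
    rw [mul_comm γ] at this
    exact lt_of_mul_lt_mul_left this hbp.le
  have hBmeas : MeasurableSet {ω | ∀ j, Z j ω ⬝ᵥ Z j ω ≤ B} := by
    rw [Set.ofPred_forall]
    refine MeasurableSet.iInter fun j => measurableSet_le ?_ measurable_const
    have : Measurable fun z : ι → ℝ => z ⬝ᵥ z :=
      (Continuous.dotProduct continuous_id continuous_id).measurable
    exact this.comp (hZ j)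
  refine ⟨{ω | f ω < b ^ (m + 1)} ∩ {ω | ∀ j, Z j ω ⬝ᵥ Z j ω ≤ B},
    (measurableSet_lt hfmeas measurable_const).inter hBmeas, ?_, ?_⟩
  · have h5 : Pr.real ({ω | f ω < b ^ (m + 1)} ∩ {ω | ∀ j, Z j ω ⬝ᵥ Z j ω ≤ B})
        = Pr.real {ω | f ω < b ^ (m + 1)} := by
      refine measureReal_congr ?_
      filter_upwards [hB] with ω hω
      refine propext ⟨fun h => h.1, fun h => ⟨h, hω⟩⟩
    have h6 : {ω | f ω < b ^ (m + 1)} = {ω | b ^ (m + 1) ≤ f ω}ᶜ := by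
      ext ω; simp
    rw [h5, h6, probReal_compl_eq_one_sub (measurableSet_le measurable_const hfmeas)]
    linarith
  · rintro ω ⟨hω1, hω2⟩
    refine ⟨hω2, fun v => ?_⟩
    have h5 := quadForm_le_of_trace_pow_lt (oneSubGram_isHermitian h _) (sub_nonneg.2 h2.le)
      (le_oneSubGram_quadForm hh0.le hω2) (oneSubGram_quadForm_le hh0.le _) h3.le hω1 v
    rw [oneSubGram_quadForm, hbh] at h5
    have h6 : h * (t * N * μ * (v ⬝ᵥ v)) ≤ h * ∑ j, (Z j ω ⬝ᵥ v) ^ 2 := by linarith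
    exact le_of_mul_le_mul_left h6 hh0

end Chernoff

/-! ### Moments of `P` and the second moment matrix of a lift. -/

section Moments

variable {P : Measure ℝ} {a : ℝ}

lemma ae_abs_le (hP_cube : ∀ᵐ s ∂P, s ∈ Set.Icc (-a) a) : ∀ᵐ s ∂P, |s| ≤ a :=
  hP_cube.mono fun _ hs => abs_le.2 hs

lemma measure_sq_eq_of_atomless (hP_atomless : ∀ s : ℝ, P {s} = 0) (c : ℝ) :
    P {s | s ^ 2 = c} = 0 := by
  have : NullSingletonClass P := ⟨hP_atomless⟩
  have h : {s : ℝ | s ^ 2 = c} ⊆ {√c, -√c} := by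
    intro s hs
    have h1 : √c = |s| := by rw [← (hs : s ^ 2 = c), Real.sqrt_sq_eq_abs]
    rcases abs_choice s with h2 | h2
    · left; rw [h1, h2]
    · right; rw [Set.mem_singleton_iff, h1, h2, neg_neg]
  exact measure_mono_null h (Set.Finite.measure_zero (by simp) P)

variable [IsProbabilityMeasure P]

lemma integrable_pow_of_cube (hP_cube : ∀ᵐ s ∂P, s ∈ Set.Icc (-a) a) (k : ℕ) :
    Integrable (fun s : ℝ => s ^ k) P := by
  refine Integrable.of_bound (continuous_pow k).aestronglyMeasurable (a ^ k) ?_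
  filter_upwards [ae_abs_le hP_cube] with s hs
  rw [Real.norm_eq_abs, abs_pow]
  exact pow_le_pow_left₀ (abs_nonneg _) hs k

lemma mom_two_pos (hP_atomless : ∀ s : ℝ, P {s} = 0) (hP_cube : ∀ᵐ s ∂P, s ∈ Set.Icc (-a) a) :
    0 < mom P 2 := by
  refine lt_of_le_of_ne (integral_nonneg fun s => sq_nonneg s) fun h => ?_
  have h1 := (integral_eq_zero_iff_of_nonneg (fun s => sq_nonneg s)
    (integrable_pow_of_cube hP_cube 2)).1 h.symm
  have h2 := prob_compl_eq_zero_iff₀ (μ := P) (s := {s : ℝ | s ^ 2 = 0})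
    (measurableSet_eq_fun (by fun_prop) (by fun_prop)).nullMeasurableSet
  have h3 : P {s : ℝ | s ^ 2 = 0} = 1 := h2.1 h1
  rw [measure_sq_eq_of_atomless hP_atomless] at h3
  exact zero_ne_one h3

/-- The difference is the variance of `s²`. If it vanished, `P` would live on at most two points
`±√c`, which are null. -/
lemma mom_two_sq_lt_mom_four (hP_atomless : ∀ s : ℝ, P {s} = 0)
    (hP_cube : ∀ᵐ s ∂P, s ∈ Set.Icc (-a) a) : mom P 2 ^ 2 < mom P 4 := by
  set c := mom P 2 with hc
  have hi2 := integrable_pow_of_cube hP_cube 2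
  have hi4 := integrable_pow_of_cube hP_cube 4
  have e : (fun s : ℝ => (s ^ 2 - c) ^ 2) = fun s => s ^ 4 - 2 * c * s ^ 2 + c ^ 2 := by
    funext s; ring
  have hi24 : Integrable (fun s : ℝ => s ^ 4 - 2 * c * s ^ 2) P := hi4.sub (hi2.const_mul _)
  have hint : Integrable (fun s : ℝ => (s ^ 2 - c) ^ 2) P := by
    rw [e]; exact hi24.add (integrable_const _)
  have hval : ∫ s, (s ^ 2 - c) ^ 2 ∂P = mom P 4 - c ^ 2 := by
    rw [e, integral_add hi24 (integrable_const _),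
      integral_sub hi4 (hi2.const_mul _), integral_const_mul]
    change mom P 4 - 2 * c * mom P 2 + _ = _
    rw [← hc]
    simp
    ring
  have h0 : 0 ≤ ∫ s, (s ^ 2 - c) ^ 2 ∂P := integral_nonneg fun s => sq_nonneg _
  rw [← sub_pos, ← hval]
  refine lt_of_le_of_ne h0 fun h => ?_
  have h1 := (integral_eq_zero_iff_of_nonneg (fun s => sq_nonneg _) hint).1 h.symm
  have h4 : ∀ᵐ s ∂P, s ∈ {s : ℝ | s ^ 2 = c} := by
    filter_upwards [h1] with s hs
    have : (s ^ 2 - c) ^ 2 = 0 := hs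
    exact sub_eq_zero.1 (pow_eq_zero_iff two_ne_zero |>.1 this)
  have h2 := prob_compl_eq_zero_iff₀ (μ := P) (s := {s : ℝ | s ^ 2 = c})
    (measurableSet_eq_fun (by fun_prop) (by fun_prop)).nullMeasurableSet
  have h3 : P {s : ℝ | s ^ 2 = c} = 1 := h2.1 h4
  rw [measure_sq_eq_of_atomless hP_atomless] at h3
  exact zero_ne_one h3

/-- The discriminant of a symmetric 2×2 block is a sum of squares, so the square root in `λ*` is
genuine. -/
lemma zeta_sq_sub_eq (P : Measure ℝ) (d : ℕ) :
    zeta P d ^ 2 - 4 * d * (mom P 4 - mom P 2 ^ 2)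
      = (d * (mom P 4 - mom P 2 ^ 2) + d ^ 2 * mom P 2 ^ 2 - 1) ^ 2 + 4 * (d * mom P 2) ^ 2 := by
  unfold zeta; ring

lemma lambdaStar_pos (hP_atomless : ∀ s : ℝ, P {s} = 0)
    (hP_cube : ∀ᵐ s ∂P, s ∈ Set.Icc (-a) a) {d : ℕ} (hd : 0 < d) : 0 < lambdaStar P d := by
  have h2 := mom_two_pos hP_atomless hP_cube
  have hv := sub_pos.2 (mom_two_sq_lt_mom_four hP_atomless hP_cube)
  have hd' : (0 : ℝ) < d := Nat.cast_pos.2 hd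
  refine lt_min ?_ (by positivity)
  have hz : 0 < zeta P d := by unfold zeta; positivity
  rw [sub_pos, Real.sqrt_lt' hz]
  have : 0 < 4 * (d : ℝ) * (mom P 4 - mom P 2 ^ 2) := by positivity
  linarith

/-- `λ* / 2` bounds the second moment form of the lifted points from below. -/
lemma lambdaStar_half_le_form (P : Measure ℝ) (d : ℕ) (α β W : ℝ) (hW : 0 ≤ W) :
    lambdaStar P d / 2 * (α ^ 2 + W + β ^ 2) ≤ (α + d * β * mom P 2) ^ 2 + mom P 2 * W
      + d * β ^ 2 * (mom P 4 - mom P 2 ^ 2) := by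
  set q := (d : ℝ) * mom P 2 with hq
  set e := (d : ℝ) * (mom P 4 - mom P 2 ^ 2) with he
  set S := √(zeta P d ^ 2 - 4 * (d : ℝ) * (mom P 4 - mom P 2 ^ 2)) with hS
  have hz : zeta P d = e + q ^ 2 + 1 := by unfold zeta; rw [he, hq]; ring
  have hS2 : S ^ 2 = (e + q ^ 2 - 1) ^ 2 + 4 * q ^ 2 := by
    rw [hS, Real.sq_sqrt]
    · rw [zeta_sq_sub_eq, he, hq]; ring
    · rw [zeta_sq_sub_eq]; positivity
  have hS0 : 0 ≤ S := Real.sqrt_nonneg _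
  have h1 : lambdaStar P d ≤ zeta P d - S := min_le_left _ _
  have h2 : lambdaStar P d ≤ 2 * mom P 2 := min_le_right _ _
  have key : (zeta P d - S) / 2 * (α ^ 2 + β ^ 2) ≤ (α + q * β) ^ 2 + e * β ^ 2 := by
    have hA : 0 ≤ S - (e + q ^ 2 - 1) := by
      have : e + q ^ 2 - 1 ≤ S := by
        rcases le_or_gt (e + q ^ 2 - 1) 0 with h | h
        · linarith
        · exact le_of_sq_le_sq (by nlinarith [sq_nonneg q]) hS0
      linarith
    have hD : 0 ≤ S + (e + q ^ 2 - 1) := by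
      have : -(e + q ^ 2 - 1) ≤ S := by
        rcases le_or_gt (-(e + q ^ 2 - 1)) 0 with h | h
        · linarith
        · exact le_of_sq_le_sq (by nlinarith [sq_nonneg q]) hS0
      linarith
    -- Subtracting the smaller eigenvalue leaves half the form with matrix `[[A, 2q], [2q, D]]`: its
    -- determinant vanishes and its diagonal is nonnegative, so it is positive semidefinite.
    have hAD : (S - (e + q ^ 2 - 1)) * (S + (e + q ^ 2 - 1)) = (2 * q) ^ 2 := by
      linear_combination hS2
    rw [hz]
    set A := S - (e + q ^ 2 - 1) with hAdef
    set D := S + (e + q ^ 2 - 1) with hDdef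
    have hform : 0 ≤ A * α ^ 2 + 2 * (2 * q) * (α * β) + D * β ^ 2 := by
      have hsA := Real.sq_sqrt hA
      have hsD := Real.sq_sqrt hD
      have hs : √A * √D = |2 * q| := by
        rw [← Real.sqrt_mul hA, hAD, Real.sqrt_sq_eq_abs]
      have h3 : -(|2 * q| * |α * β|) ≤ 2 * q * (α * β) := by
        rw [← abs_mul]; exact neg_abs_le _
      rw [← hs, abs_mul] at h3
      have h4 := sq_nonneg (√A * |α| - √D * |β|)
      have h5 : (√A * |α| - √D * |β|) ^ 2
          = A * α ^ 2 - 2 * (√A * √D * (|α| * |β|)) + D * β ^ 2 := by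
        rw [← hsA, ← hsD, ← sq_abs α, ← sq_abs β, Real.sqrt_sq (Real.sqrt_nonneg _),
          Real.sqrt_sq (Real.sqrt_nonneg _)]
        ring
      linarith
    have : (α + q * β) ^ 2 + e * β ^ 2 - (e + q ^ 2 + 1 - S) / 2 * (α ^ 2 + β ^ 2)
        = (A * α ^ 2 + 2 * (2 * q) * (α * β) + D * β ^ 2) / 2 := by
      rw [hAdef, hDdef]; ring
    linarith
  have h3 := mul_le_mul_of_nonneg_right h1 (by positivity : 0 ≤ α ^ 2 + β ^ 2)
  have h4 := mul_le_mul_of_nonneg_right h2 hW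
  have e1 : (α + d * β * mom P 2) ^ 2 + mom P 2 * W + d * β ^ 2 * (mom P 4 - mom P 2 ^ 2)
      = (α + q * β) ^ 2 + e * β ^ 2 + mom P 2 * W := by rw [he, hq]; ring
  rw [e1]
  linarith

variable {Ω : Type*} [MeasurableSpace Ω] {Pr : Measure Ω} [IsProbabilityMeasure Pr]

/-- The second moment of `α + ∑ j, (w j X j + β (X j)²)` for independent `X j` with law `P`. -/
lemma integral_sq_linear_add_sq {d : ℕ} (hP_cube : ∀ᵐ s ∂P, s ∈ Set.Icc (-a) a)
    (hm1 : mom P 1 = 0) (hm3 : mom P 3 = 0) {X : Fin d → Ω → ℝ} (hX : ∀ j, Measurable (X j))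
    (hlaw : ∀ j, Measure.map (X j) Pr = P) (hind : iIndepFun X Pr) (α β : ℝ) (w : Fin d → ℝ) :
    ∫ ω, (α + ∑ j, (w j * X j ω + β * X j ω ^ 2)) ^ 2 ∂Pr
      = (α + d * β * mom P 2) ^ 2 + mom P 2 * ∑ j, w j ^ 2
        + d * β ^ 2 * (mom P 4 - mom P 2 ^ 2) := by
  have hmom : ∀ j k, ∫ ω, X j ω ^ k ∂Pr = mom P k := by
    intro j k
    rw [mom, ← hlaw j, integral_map (hX j).aemeasurable (continuous_pow k).aestronglyMeasurable]
  have hint : ∀ j k, Integrable (fun ω => X j ω ^ k) Pr := by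
    intro j k
    have := integrable_pow_of_cube hP_cube k
    rw [← hlaw j] at this
    exact this.comp_measurable (hX j)
  have hint1 : ∀ j, Integrable (X j) Pr := fun j => by simpa using hint j 1
  have hmom1 : ∀ j, ∫ ω, X j ω ∂Pr = 0 := fun j => by simpa [hm1] using hmom j 1
  set Y : Fin d → Ω → ℝ := fun j ω => w j * X j ω + β * X j ω ^ 2 with hY
  have hYmeas : ∀ j, Measurable (Y j) := fun j =>
    ((hX j).const_mul _).add (((hX j).pow_const 2).const_mul _)
  have eYsq : ∀ j, (fun ω => Y j ω ^ 2)
      = fun ω => w j ^ 2 * X j ω ^ 2 + 2 * w j * β * X j ω ^ 3 + β ^ 2 * X j ω ^ 4 := by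
    intro j; funext ω; simp only [hY]; ring
  have hYsq : ∀ j, Integrable (fun ω => Y j ω ^ 2) Pr := by
    intro j
    rw [eYsq]
    exact (((hint j 2).const_mul _).add ((hint j 3).const_mul _)).add ((hint j 4).const_mul _)
  have hYint : ∀ j, Integrable (Y j) Pr := fun j =>
    ((hint1 j).const_mul _).add ((hint j 2).const_mul _)
  have hYL : ∀ j, MemLp (Y j) 2 Pr := fun j =>
    (memLp_two_iff_integrable_sq (hYmeas j).aestronglyMeasurable).2 (hYsq j)
  have hEY : ∀ j, ∫ ω, Y j ω ∂Pr = β * mom P 2 := by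
    intro j
    simp only [hY]
    rw [integral_add ((hint1 j).const_mul _) ((hint j 2).const_mul _), integral_const_mul,
      integral_const_mul, hmom1, hmom]
    ring
  have hEYsq : ∀ j, ∫ ω, Y j ω ^ 2 ∂Pr = w j ^ 2 * mom P 2 + β ^ 2 * mom P 4 := by
    intro j
    have h23 : Integrable (fun ω => w j ^ 2 * X j ω ^ 2 + 2 * w j * β * X j ω ^ 3) Pr :=
      ((hint j 2).const_mul _).add ((hint j 3).const_mul _)
    rw [eYsq, integral_add h23 ((hint j 4).const_mul _), integral_add ((hint j 2).const_mul _) ((hint j 3).const_mul _),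
      integral_const_mul, integral_const_mul, integral_const_mul, hmom, hmom, hmom, hm3]
    ring
  -- No cross term `w j * β` survives: `m₃ = 0` removes it from the second moment and `m₁ = 0` from
  -- the squared mean.
  have hVarY : ∀ j, variance (Y j) Pr = w j ^ 2 * mom P 2 + β ^ 2 * (mom P 4 - mom P 2 ^ 2) := by
    intro j
    rw [variance_eq_sub (hYL j)]
    have e1 : ∫ ω, (Y j ^ 2) ω ∂Pr = ∫ ω, Y j ω ^ 2 ∂Pr := rfl
    rw [e1, hEYsq, hEY]
    ring
  have hVar : variance (∑ j, Y j) Pr = ∑ j, variance (Y j) Pr := by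
    refine IndepFun.variance_sum (fun j _ => hYL j) fun i _ j _ hij => ?_
    have hφ : ∀ c : ℝ, Measurable fun s : ℝ => c * s + β * s ^ 2 := fun c => by fun_prop
    exact (hind.indepFun hij).comp (hφ (w i)) (hφ (w j))
  have hSL : MemLp (∑ j, Y j) 2 Pr := memLp_finsetSum' _ fun j _ => hYL j
  have hS : (fun ω => ∑ j, Y j ω) = ∑ j, Y j := by funext ω; simp
  have hES : ∫ ω, (∑ j, Y j ω) ∂Pr = d * β * mom P 2 := by
    rw [integral_finsetSum _ fun j _ => hYint j]
    simp [hEY]; ring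
  have hSint : Integrable (fun ω => ∑ j, Y j ω) Pr := integrable_finsetSum _ fun j _ => hYint j
  have hSsq : Integrable (fun ω => (∑ j, Y j ω) ^ 2) Pr := by
    have := hSL.integrable_sq
    simpa using this
  have hESsq : ∫ ω, (∑ j, Y j ω) ^ 2 ∂Pr = (d * β * mom P 2) ^ 2 + mom P 2 * ∑ j, w j ^ 2
        + d * β ^ 2 * (mom P 4 - mom P 2 ^ 2) := by
    have h1 := variance_eq_sub hSL
    rw [hVar, ← hS] at h1
    have e1 : ∫ ω, ((fun ω => ∑ j, Y j ω) ^ 2) ω ∂Pr = ∫ ω, (∑ j, Y j ω) ^ 2 ∂Pr := rfl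
    rw [e1, hES, Finset.sum_congr rfl fun j _ => hVarY j, Finset.sum_add_distrib,
      ← Finset.sum_mul] at h1
    simp only [sum_const, card_univ, Fintype.card_fin, nsmul_eq_mul] at h1
    linarith
  have e2 : (fun ω => (α + ∑ j, Y j ω) ^ 2)
      = fun ω => α ^ 2 + 2 * α * (∑ j, Y j ω) + (∑ j, Y j ω) ^ 2 := by
    funext ω; ring
  change ∫ ω, (α + ∑ j, Y j ω) ^ 2 ∂Pr = _
  have hlin : Integrable (fun ω => α ^ 2 + 2 * α * ∑ j, Y j ω) Pr :=
    (integrable_const _).add (hSint.const_mul _)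
  rw [e2, integral_add hlin hSsq,
    integral_add (integrable_const _) (hSint.const_mul _), integral_const_mul, hES, hESsq]
  simp
  ring

end Moments

/-! ### Projections onto subspaces of the range of a tall matrix. -/

section Coherence

variable {ι : Type*} [Fintype ι]

/-- A subspace inside the range of a tall matrix `X` that is bounded below has incoherent
coordinate directions. -/
lemma norm_starProjection_single_sq_le {N : ℕ} {X : Fin N → ι → ℝ} {B c : ℝ} (hc : 0 < c)
    (hB : ∀ i, X i ⬝ᵥ X i ≤ B) (hX : ∀ w, c * (w ⬝ᵥ w) ≤ ∑ i, (X i ⬝ᵥ w) ^ 2)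
    {U : Submodule ℝ (EuclideanSpace ℝ (Fin N))}
    (hU : ∀ y ∈ U, ∃ w : ι → ℝ, ∀ i, y i = X i ⬝ᵥ w) (i : Fin N) :
    ‖U.starProjection (EuclideanSpace.single i (1 : ℝ))‖ ^ 2 ≤ B / c := by
  set e : EuclideanSpace ℝ (Fin N) := EuclideanSpace.single i (1 : ℝ)
  set y := U.starProjection e with hy
  obtain ⟨w, hw⟩ := hU y (U.starProjection_apply_mem e)
  have h1 : ‖y‖ ^ 2 = y i := by
    have h2 : inner ℝ y y = inner ℝ y e := by
      conv_lhs => enter [3]; rw [hy]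
      rw [← U.inner_starProjection_left_eq_right,
        U.starProjection_eq_self_iff.2 (U.starProjection_apply_mem e)]
    rw [← real_inner_self_eq_norm_sq, h2, EuclideanSpace.inner_single_right]
    simp
  have h3 : ‖y‖ ^ 2 = ∑ j, (X j ⬝ᵥ w) ^ 2 := by
    rw [EuclideanSpace.norm_sq_eq]
    exact Finset.sum_congr rfl fun j _ => by rw [hw, Real.norm_eq_abs, sq_abs]
  have h4 : (‖y‖ ^ 2) ^ 2 ≤ B * (w ⬝ᵥ w) := by
    conv_lhs => rw [h1, hw]
    exact (sq_dotProduct_le _ _).trans (mul_le_mul_of_nonneg_right (hB i)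
      (Finset.sum_nonneg fun i _ => mul_self_nonneg _))
  have hB0 : 0 ≤ B := le_trans (Finset.sum_nonneg fun j _ => mul_self_nonneg _) (hB i)
  have h5 : c * (w ⬝ᵥ w) ≤ ‖y‖ ^ 2 := h3 ▸ hX w
  rw [le_div_iff₀ hc]
  rcases (sq_nonneg ‖y‖).eq_or_lt with h0 | h0
  · rw [← h0]; simpa using hB0
  · have h6 : ‖y‖ ^ 2 * (‖y‖ ^ 2 * c) ≤ ‖y‖ ^ 2 * B := by
      nlinarith [mul_le_mul_of_nonneg_left h5 hB0, mul_le_mul_of_nonneg_right h4 hc.le]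
    exact le_of_mul_le_mul_left h6 h0

lemma finrank_colSpace {K L : ℕ} (M : Matrix (Fin K) (Fin L) ℝ) :
    Module.finrank ℝ (colSpace M) = M.rank := by
  rw [rank_eq_finrank_span_cols]
  have : colSpace M = (Submodule.span ℝ (Set.range M.col)).map
      (WithLp.linearEquiv 2 ℝ (Fin K → ℝ)).symm.toLinearMap := by
    rw [Submodule.map_span, ← Set.range_comp]
    rfl
  rw [this]
  exact LinearEquiv.finrank_map_eq _ _

lemma rowSpace_eq_colSpace {N : ℕ} {M : Matrix (Fin N) (Fin N) ℝ} (hM : M.IsHermitian) :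
    rowSpace M = colSpace M := by
  unfold rowSpace colSpace
  congr 2
  funext i
  congr 1
  funext j
  simpa using hM.apply j i

lemma coherence_le {N : ℕ} (hN : 0 < N) {U : Submodule ℝ (EuclideanSpace ℝ (Fin N))} {ρ : ℝ}
    (h : ∀ i, ‖U.starProjection (EuclideanSpace.single i (1 : ℝ))‖ ^ 2 ≤ ρ) :
    coherence U ≤ N / Module.finrank ℝ U * ρ := by
  have : Nonempty (Fin N) := ⟨⟨0, hN⟩⟩
  exact mul_le_mul_of_nonneg_left (ciSup_le h) (by positivity)

end Coherence

/-! ### Compact singular value decompositions. -/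

section SVD

/-- A real symmetric matrix has a compact singular value decomposition. -/
lemma exists_isCompactSVD {N : ℕ} {M : Matrix (Fin N) (Fin N) ℝ} (hM : M.IsHermitian) :
    ∃ (r : ℕ) (u : Fin r → EuclideanSpace ℝ (Fin N)) (σ : Fin r → ℝ)
      (v : Fin r → EuclideanSpace ℝ (Fin N)), IsCompactSVD M u σ v := by
  obtain ⟨l, u, h1, -, h3⟩ := exists_spectral_pow hM
  let e := Fintype.equivFin {i // l i ≠ 0}
  have hinner : ∀ i j, inner ℝ (WithLp.toLp 2 (u i) : EuclideanSpace ℝ (Fin N))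
      (WithLp.toLp 2 (u j)) = if i = j then (1 : ℝ) else 0 := by
    intro i j
    rw [← h1 i j]
    simp [PiLp.inner_apply, dotProduct, mul_comm]
  -- Only nonzero eigenvalues are kept, and their signs are moved into the right vectors.
  refine ⟨_, fun k => WithLp.toLp 2 (u (e.symm k)), fun k => |l (e.symm k)|,
    fun k => (l (e.symm k) / |l (e.symm k)|) •
      (WithLp.toLp 2 (u (e.symm k)) : EuclideanSpace ℝ (Fin N)), ?_, ?_, ?_, ?_⟩
  · rw [orthonormal_iff_ite]
    intro i j
    rw [hinner]
    simp [Subtype.ext_iff.symm]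
  · rw [orthonormal_iff_ite]
    intro i j
    rw [inner_smul_left, inner_smul_right, hinner]
    rcases eq_or_ne i j with rfl | hij
    · have h4 : |l (e.symm i)| ≠ 0 := abs_ne_zero.2 (e.symm i).2
      simp only [if_true, conj_trivial, mul_one]
      rw [div_mul_div_comm, abs_mul_abs_self, div_self (mul_self_ne_zero.2 (e.symm i).2)]
    · simp [Subtype.ext_iff.symm, hij]
  · intro k
    exact abs_pos.2 (e.symm k).2
  · intro i j
    have h4 := h3 1 i j
    rw [pow_one] at h4
    have h5 : ∑ k, l k ^ 1 * (u k i * u k j)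
        = ∑ k : {k // l k ≠ 0}, l k * (u k i * u k j) := by
      simp only [pow_one]
      rw [← Finset.sum_subtype (univ.filter fun k => l k ≠ 0) (by simp)
        (fun k => l k * (u k i * u k j)), Finset.sum_filter_of_ne]
      intro k _ hk h
      simp [h] at hk
    rw [h4, h5, ← e.symm.sum_comp]
    refine Finset.sum_congr rfl fun k _ => ?_
    have h6 : |l (e.symm k)| ≠ 0 := abs_ne_zero.2 (e.symm k).2
    simp only [PiLp.smul_apply, smul_eq_mul]
    field_simp

variable {K L r : ℕ} {M : Matrix (Fin K) (Fin L) ℝ} {u : Fin r → EuclideanSpace ℝ (Fin K)}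
  {σ : Fin r → ℝ} {v : Fin r → EuclideanSpace ℝ (Fin L)}

lemma IsCompactSVD.transpose (h : IsCompactSVD M u σ v) : IsCompactSVD Mᵀ v σ u where
  orthonormal_left := h.orthonormal_right
  orthonormal_right := h.orthonormal_left
  pos := h.pos
  eq_sum i j := by
    rw [transpose_apply, h.eq_sum]
    exact Finset.sum_congr rfl fun k _ => by ring

/-- Orthonormality of the `v k` gives `u k = (σ k)⁻¹ M (v k)`. -/
lemma IsCompactSVD.left_mem_colSpace (h : IsCompactSVD M u σ v) (k : Fin r) :
    u k ∈ colSpace M := by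
  have h1 : u k = ∑ j, ((σ k)⁻¹ * v k j) • (WithLp.toLp 2 fun i => M i j) := by
    ext i
    simp only [WithLp.ofLp_sum, Finset.sum_apply, PiLp.smul_apply, smul_eq_mul, h.eq_sum,
      Finset.mul_sum]
    rw [Finset.sum_comm]
    have h2 : ∀ l, ∑ j, v k j * v l j = if k = l then 1 else 0 := by
      intro l
      rw [← orthonormal_iff_ite.1 h.orthonormal_right k l]
      simp [PiLp.inner_apply, mul_comm]
    have h3 : ∀ l, ∑ j, (σ k)⁻¹ * v k j * (σ l * (u l i * v l j))
        = (σ k)⁻¹ * σ l * u l i * if k = l then 1 else 0 := by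
      intro l
      rw [← h2, Finset.mul_sum]
      exact Finset.sum_congr rfl fun j _ => by ring
    simp [h3, (h.pos k).ne']
  rw [h1]
  exact Submodule.sum_mem _ fun j _ => Submodule.smul_mem _ _ (Submodule.subset_span ⟨j, rfl⟩)

lemma IsCompactSVD.eq_rank (h : IsCompactSVD M u σ v) : r = M.rank := by
  have h1 : colSpace M = Submodule.span ℝ (Set.range u) := by
    apply le_antisymm
    · refine Submodule.span_le.2 ?_
      rintro _ ⟨j, rfl⟩
      have : (WithLp.toLp 2 fun i => M i j) = ∑ k, (σ k * v k j) • u k := by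
        ext i
        simp only [WithLp.ofLp_sum, Finset.sum_apply, PiLp.smul_apply, smul_eq_mul, h.eq_sum]
        exact Finset.sum_congr rfl fun k _ => by ring
      change (WithLp.toLp 2 fun i => M i j : EuclideanSpace ℝ (Fin K)) ∈ Submodule.span ℝ (Set.range u)
      rw [this]
      exact Submodule.sum_mem _ fun k _ => Submodule.smul_mem _ _ (Submodule.subset_span ⟨k, rfl⟩)
    · refine Submodule.span_le.2 ?_
      rintro _ ⟨k, rfl⟩
      exact h.left_mem_colSpace k
  rw [← finrank_colSpace, h1, finrank_span_eq_card h.orthonormal_left.linearIndependent,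
    Fintype.card_fin]

/-- Bessel's inequality for the projected basis vector: since `u k` lies in the column space, its
inner product with `e_i` is unchanged by projecting `e_i`. -/
lemma IsCompactSVD.sum_left_sq_le (h : IsCompactSVD M u σ v) (i : Fin K) :
    ∑ k, u k i ^ 2 ≤ ‖(colSpace M).starProjection (EuclideanSpace.single i (1 : ℝ))‖ ^ 2 := by
  refine le_trans (le_of_eq ?_) (h.orthonormal_left.sum_inner_products_le _ (s := univ))
  refine Finset.sum_congr rfl fun k _ => ?_
  rw [← Submodule.inner_starProjection_left_eq_right,
    (Submodule.starProjection_eq_self_iff).2 (h.left_mem_colSpace k),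
    EuclideanSpace.inner_single_right]
  simp

lemma IsCompactSVD.abs_sum_le (h : IsCompactSVD M u σ v) {ρ : ℝ} {i : Fin K} {j : Fin L}
    (hi : ‖(colSpace M).starProjection (EuclideanSpace.single i (1 : ℝ))‖ ^ 2 ≤ ρ)
    (hj : ‖(rowSpace M).starProjection (EuclideanSpace.single j (1 : ℝ))‖ ^ 2 ≤ ρ) :
    |∑ k, u k i * v k j| ≤ ρ := by
  have h1 := (h.sum_left_sq_le i).trans hi
  have h2 := (h.transpose.sum_left_sq_le j).trans hj
  have h3 := Finset.sum_mul_sq_le_sq_mul_sq univ (fun k => u k i) (fun k => v k j)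
  have h0 : 0 ≤ ∑ k, u k i ^ 2 := Finset.sum_nonneg fun k _ => sq_nonneg _
  have h0' : 0 ≤ ∑ k, v k j ^ 2 := Finset.sum_nonneg fun k _ => sq_nonneg _
  refine abs_le_of_sq_le_sq (h3.trans ?_) (h0.trans h1)
  rw [sq ρ]
  exact mul_le_mul h1 h2 h0' (h0.trans h1)

end SVD

/-! ### The lift factorization of the distance matrix. -/

section Lift

/-- The lift `(1, ∑ (p k)², p)` of a point to the paraboloid. -/
def lift {d : ℕ} (p : Fin d → ℝ) : Option (Option (Fin d)) → ℝ
  | none => 1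
  | some none => ∑ k, p k ^ 2
  | some (some k) => p k

/-- The dual lift `(∑ (p k)², 1, -2 p)`. -/
def coLift {d : ℕ} (p : Fin d → ℝ) : Option (Option (Fin d)) → ℝ
  | none => ∑ k, p k ^ 2
  | some none => 1
  | some (some k) => -2 * p k

lemma lift_dotProduct {d : ℕ} (p : Fin d → ℝ) (v : Option (Option (Fin d)) → ℝ) :
    lift p ⬝ᵥ v = v none + ∑ k, (v (some (some k)) * p k + v (some none) * p k ^ 2) := by
  simp only [dotProduct, Fintype.sum_option, lift, Finset.sum_add_distrib, ← Finset.mul_sum]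
  rw [Finset.sum_congr rfl fun k _ => mul_comm (p k) _]
  ring

lemma lift_dotProduct_self_le {d : ℕ} {p : Fin d → ℝ} {a : ℝ} (hp : ∀ k, |p k| ≤ a) :
    lift p ⬝ᵥ lift p ≤ 1 + d * a ^ 2 + d ^ 2 * a ^ 4 := by
  have h1 : ∑ k, p k ^ 2 ≤ d * a ^ 2 := by
    have := Finset.sum_le_card_nsmul univ (fun k => p k ^ 2) (a ^ 2) fun k _ =>
      sq_le_sq' (abs_le.1 (hp k)).1 (abs_le.1 (hp k)).2
    simpa using this
  have h0 : 0 ≤ ∑ k, p k ^ 2 := Finset.sum_nonneg fun k _ => sq_nonneg _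
  have h2 : lift p ⬝ᵥ lift p = 1 + ∑ k, p k ^ 2 + (∑ k, p k ^ 2) ^ 2 := by
    simp only [dotProduct, Fintype.sum_option, lift, ← sq]
    ring
  rw [h2]
  nlinarith [pow_le_pow_left₀ h0 h1 2]

lemma continuous_lift {d : ℕ} : Continuous (lift : (Fin d → ℝ) → _) := by
  refine continuous_pi fun o => ?_
  rcases o with _ | _ | k
  · exact continuous_const
  · exact continuous_finsetSum _ fun k _ => (continuous_apply k).pow 2
  · exact continuous_apply k

lemma edm_eq_lift_mul {N d : ℕ} (p : Fin N → Fin d → ℝ) :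
    edm (fun i => WithLp.toLp 2 (p i))
      = (Matrix.of fun i => lift (p i)) * (Matrix.of fun i => coLift (p i))ᵀ := by
  ext i j
  simp only [edm, Matrix.of_apply, Matrix.mul_apply, Matrix.transpose_apply, Fintype.sum_option,
    lift, coLift, EuclideanSpace.norm_sq_eq, PiLp.sub_apply, Real.norm_eq_abs, sq_abs]
  rw [one_mul, mul_one, ← Finset.sum_add_distrib, ← Finset.sum_add_distrib]
  exact Finset.sum_congr rfl fun k _ => by ring

lemma edm_isHermitian {N d : ℕ} (p : Fin N → EuclideanSpace ℝ (Fin d)) :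
    (edm p).IsHermitian := by
  ext i j
  simp [edm, norm_sub_rev]

lemma rank_edm_le {N d : ℕ} (p : Fin N → Fin d → ℝ) :
    (edm fun i => WithLp.toLp 2 (p i)).rank ≤ d + 2 := by
  rw [edm_eq_lift_mul]
  refine (rank_mul_le_left _ _).trans ((rank_le_card_width _).trans_eq ?_)
  simp

lemma mem_colSpace_edm {N d : ℕ} (p : Fin N → Fin d → ℝ) {y : EuclideanSpace ℝ (Fin N)}
    (hy : y ∈ colSpace (edm fun i => WithLp.toLp 2 (p i))) :
    ∃ w, ∀ i, y i = lift (p i) ⬝ᵥ w := by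
  induction hy using Submodule.span_induction with
  | mem y hy =>
    obtain ⟨j, rfl⟩ := hy
    refine ⟨coLift (p j), fun i => ?_⟩
    change edm _ i j = _
    rw [edm_eq_lift_mul]
    rfl
  | zero => exact ⟨0, fun i => by simp⟩
  | add y z _ _ hy hz =>
    obtain ⟨w, hw⟩ := hy
    obtain ⟨w', hw'⟩ := hz
    exact ⟨w + w', fun i => by rw [dotProduct_add, ← hw, ← hw']; rfl⟩
  | smul c y _ hy =>
    obtain ⟨w, hw⟩ := hy
    exact ⟨c • w, fun i => by rw [dotProduct_smul, ← hw]; rfl⟩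

lemma isUnit_transpose_mul_self {m n : Type*} [Fintype m] [Fintype n] [DecidableEq n]
    {A : Matrix m n ℝ} (hA : ∀ w, A *ᵥ w = 0 → w = 0) : IsUnit (Aᵀ * A) := by
  refine mulVec_injective_iff_isUnit.1 ?_
  rw [← coe_mulVecLin, ← LinearMap.ker_eq_bot, ker_mulVecLin_transpose_mul_self,
    LinearMap.ker_eq_bot']
  exact hA

/-- The product `Xᵀ (X Yᵀ) Y = (Xᵀ X) (Yᵀ Y)` of size `d + 2` is invertible once `X` and `Y` are
injective, and multiplication cannot raise the rank. -/
lemma rank_edm_eq {N d : ℕ} {p : Fin N → Fin d → ℝ} {c : ℝ} (hc : 0 < c)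
    (hX : ∀ w, c * (w ⬝ᵥ w) ≤ ∑ i, (lift (p i) ⬝ᵥ w) ^ 2) :
    (edm fun i => WithLp.toLp 2 (p i)).rank = d + 2 := by
  refine le_antisymm (rank_edm_le p) ?_
  set X : Matrix (Fin N) (Option (Option (Fin d))) ℝ := Matrix.of fun i => lift (p i) with hXdef
  set Y : Matrix (Fin N) (Option (Option (Fin d))) ℝ := Matrix.of fun i => coLift (p i) with hYdef
  have hXinj : ∀ w, X *ᵥ w = 0 → w = 0 := by
    intro w hw
    have h1 := hX w
    have h2 : ∀ i, lift (p i) ⬝ᵥ w = 0 := fun i => congrFun hw i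
    simp only [h2, ne_eq, OfNat.ofNat_ne_zero, not_false_eq_true, zero_pow, sum_const_zero] at h1
    have h3 : w ⬝ᵥ w ≤ 0 := by
      by_contra h
      exact absurd h1 (not_le.2 (mul_pos hc (not_le.1 h)))
    exact dotProduct_self_eq_zero.1
      (le_antisymm h3 (Finset.sum_nonneg fun i _ => mul_self_nonneg _))
  have hYinj : ∀ w, Y *ᵥ w = 0 → w = 0 := by
    intro w hw
    -- Chosen so that `X w' = Y w`: the dual lift swaps the first two coordinates of the lift and
    -- scales the others by `-2`.
    let w' : Option (Option (Fin d)) → ℝ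
      | none => w (some none)
      | some none => w none
      | some (some k) => -2 * w (some (some k))
    have h1 : X *ᵥ w' = 0 := by
      rw [← hw]
      funext i
      simp only [mulVec, dotProduct, Fintype.sum_option, hXdef, hYdef, Matrix.of_apply, lift,
        coLift, w']
      have h2 : ∑ k, p i k * (-2 * w (some (some k))) = ∑ k, -2 * p i k * w (some (some k)) :=
        Finset.sum_congr rfl fun k _ => by ring
      rw [h2]
      ring
    have h2 := hXinj w' h1
    funext o
    rcases o with _ | _ | k
    · exact congrFun h2 (some none)
    · exact congrFun h2 none
    · have : -2 * w (some (some k)) = 0 := congrFun h2 (some (some k))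
      simpa using this
  have hunit : IsUnit (Xᵀ * (X * Yᵀ) * Y) := by
    have : Xᵀ * (X * Yᵀ) * Y = (Xᵀ * X) * (Yᵀ * Y) := by
      simp only [Matrix.mul_assoc]
    rw [this]
    exact (isUnit_transpose_mul_self hXinj).mul (isUnit_transpose_mul_self hYinj)
  have h1 := rank_of_isUnit _ hunit
  rw [edm_eq_lift_mul]
  calc d + 2 = (Xᵀ * (X * Yᵀ) * Y).rank := by rw [h1]; simp
    _ ≤ (Xᵀ * (X * Yᵀ)).rank := rank_mul_le_left _ _
    _ ≤ (X * Yᵀ).rank := rank_mul_le_right _ _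

/-- The rank and the assumptions A0 and A1 for the distance matrix of points whose lifts form a
well-conditioned system. -/
lemma edm_obeys {N d : ℕ} (hN : 0 < N) {p : Fin N → Fin d → ℝ} {B c : ℝ} (hc : 0 < c)
    (hB0 : 0 < B) (hB : ∀ i, lift (p i) ⬝ᵥ lift (p i) ≤ B)
    (hX : ∀ w, c * (w ⬝ᵥ w) ≤ ∑ i, (lift (p i) ⬝ᵥ w) ^ 2) :
    (edm fun i => WithLp.toLp 2 (p i)).rank = d + 2 ∧
    ObeysA0 (edm fun i => WithLp.toLp 2 (p i)) (N * B / c / (d + 2)) ∧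
    ObeysA1 (edm fun i => WithLp.toLp 2 (p i)) (N * B / c / √(d + 2)) := by
  set M := edm fun i => WithLp.toLp 2 (p i) with hM
  have hrank : M.rank = d + 2 := rank_edm_eq hc hX
  have hsymm : M.IsHermitian := edm_isHermitian _
  have hrow := rowSpace_eq_colSpace hsymm
  have hproj : ∀ i, ‖(colSpace M).starProjection (EuclideanSpace.single i (1 : ℝ))‖ ^ 2 ≤ B / c :=
    norm_starProjection_single_sq_le hc hB hX fun y hy => mem_colSpace_edm p hy
  have hN' : (0 : ℝ) < N := Nat.cast_pos.2 hN
  refine ⟨hrank, ⟨by positivity, ?_⟩, by positivity, exists_isCompactSVD hsymm, ?_⟩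
  · rw [hrow, max_self]
    refine (coherence_le hN hproj).trans_eq ?_
    rw [finrank_colSpace, hrank]
    push_cast
    field_simp
  · intro r u σ v h i j
    refine (h.abs_sum_le (hproj i) (by rw [hrow]; exact hproj j)).trans_eq ?_
    have hr : (r : ℝ) = d + 2 := by
      rw [h.eq_rank, hrank]; push_cast; rfl
    rw [hr, Real.sqrt_div (by positivity), Real.sqrt_mul_self hN'.le]
    field_simp

end Lift

/-! ### Scalar estimates, independence of the lifts, and the theorem. -/

lemma sq_div_two_lt_one_sub_add_mul_log {t : ℝ} (ht : t ∈ Set.Ioo (0 : ℝ) 1) :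
    (1 - t) ^ 2 / 2 < 1 - t + t * Real.log t := by
  have h1 : 0 < -Real.log t := neg_pos.2 (Real.log_neg ht.1 ht.2)
  -- At `s = -log t`, `s < sinh s` says `-t log t < (1 - t²) / 2`, which rearranges to the claim.
  have h2 := Real.self_lt_sinh_iff.2 h1
  rw [Real.sinh_eq, neg_neg, Real.exp_neg, Real.exp_log ht.1] at h2
  have h3 := mul_lt_mul_of_pos_left h2 ht.1
  have h4 : t * ((t⁻¹ - t) / 2) = (1 - t ^ 2) / 2 := by
    have := ht.1.ne'
    field_simp
  nlinarith

lemma card_mul_exp_lt {D N θ t γ : ℝ} (hD : 1 < D) (hθ : 0 < θ) (ht : t ∈ Set.Ioo (0 : ℝ) 1)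
    (hγ : γ ∈ Set.Ioc (0 : ℝ) 1)
    (hN : 2 * θ * (Real.log D - Real.log γ) / (1 - t) ^ 2 ≤ N) :
    0 < N ∧ D * Real.exp (-(1 - t + t * Real.log t) * (N / θ)) < γ := by
  have hL : 0 < Real.log D - Real.log γ := by
    have h1 := Real.log_pos hD
    have h2 := Real.log_nonpos hγ.1.le hγ.2
    linarith
  have ht1 : 0 < 1 - t := sub_pos.2 ht.2
  have hN0 : 0 < N := lt_of_lt_of_le (by positivity) hN
  refine ⟨hN0, ?_⟩
  have h1 : Real.log D - Real.log γ ≤ (1 - t) ^ 2 / 2 * (N / θ) := by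
    rw [div_le_iff₀ (by positivity)] at hN
    rw [div_mul_div_comm, le_div_iff₀ (by positivity)]
    linarith
  have h2 : Real.log D - Real.log γ < (1 - t + t * Real.log t) * (N / θ) :=
    h1.trans_lt (mul_lt_mul_of_pos_right (sq_div_two_lt_one_sub_add_mul_log ht) (by positivity))
  have hD0 : 0 < D := by linarith
  calc D * Real.exp (-(1 - t + t * Real.log t) * (N / θ))
      < D * Real.exp (Real.log γ - Real.log D) := by
        refine mul_lt_mul_of_pos_left (Real.exp_lt_exp.2 ?_) hD0
        linarith
    _ = γ := by
        rw [Real.exp_sub, Real.exp_log hγ.1, Real.exp_log hD0]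
        field_simp

/-- The lifts of the points are independent when all their coordinates are. -/
lemma indepFun_lift {d N : ℕ} {Ω : Type*} [MeasurableSpace Ω] {Pr : Measure Ω}
    {x : Fin N → Fin d → Ω → ℝ} (hx_meas : ∀ i j, Measurable (x i j))
    (hx_indep : iIndepFun (fun (ij : Fin N × Fin d) => x ij.1 ij.2) Pr)
    (s : Finset (Fin N)) (i : Fin N) (hi : i ∉ s) :
    IndepFun (fun ω (j : s) => lift fun k => x j k ω) (fun ω => lift fun k => x i k ω) Pr := by
  have hdisj : Disjoint (s ×ˢ (univ : Finset (Fin d))) ({i} ×ˢ (univ : Finset (Fin d))) := by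
    rw [Finset.disjoint_left]
    rintro ⟨j, k⟩ h1 h2
    simp only [mem_product, mem_univ, and_true, mem_singleton] at h1 h2
    exact hi (h2 ▸ h1)
  have h := hx_indep.indepFun_finset _ _ hdisj fun ij => hx_meas ij.1 ij.2
  have hF : Measurable fun (y : ↥(s ×ˢ (univ : Finset (Fin d))) → ℝ) (j : s) =>
      lift fun k => y ⟨(j, k), mem_product.2 ⟨j.2, mem_univ k⟩⟩ :=
    measurable_pi_lambda _ fun j => continuous_lift.measurable.comp
      (measurable_pi_lambda _ fun k => measurable_pi_apply _)
  have hG : Measurable fun (y : ↥({i} ×ˢ (univ : Finset (Fin d))) → ℝ) =>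
      lift fun k => y ⟨(i, k), mem_product.2 ⟨mem_singleton_self i, mem_univ k⟩⟩ :=
    continuous_lift.measurable.comp (measurable_pi_lambda _ fun k => measurable_pi_apply _)
  exact h.comp hF hG

end RandomEDM

theorem theorem3 {d N : ℕ} (hd : 0 < d) {a : ℝ} (ha : 0 < a)
    -- the common law of the coordinates
    (P : Measure ℝ) [IsProbabilityMeasure P]
    (hP_atomless : ∀ s : ℝ, P {s} = 0)
    (hP_cube : ∀ᵐ s ∂P, s ∈ Set.Icc (-a) a)
    (hm1 : RandomEDM.mom P 1 = 0) (hm3 : RandomEDM.mom P 3 = 0)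
    -- the independent coordinates `x i j` of the `N` random points
    {Ω : Type*} [MeasurableSpace Ω] (Pr : Measure Ω) [IsProbabilityMeasure Pr]
    (x : Fin N → Fin d → Ω → ℝ)
    (hx_meas : ∀ i j, Measurable (x i j))
    (hx_law : ∀ i j, Measure.map (x i j) Pr = P)
    (hx_indep : iIndepFun (fun (ij : Fin N × Fin d) => x ij.1 ij.2) Pr)
    {t γ : ℝ} (ht : t ∈ Set.Ioo (0 : ℝ) 1) (hγ : γ ∈ Set.Ioc (0 : ℝ) 1)
    (hN : 2 * RandomEDM.theta P d a * (Real.log ((d : ℝ) + 2) - Real.log γ) / (1 - t) ^ 2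
      ≤ (N : ℝ)) :
    (∀ ω, (RandomEDM.edm fun i => WithLp.toLp 2 fun j => x i j ω).rank ≤ d + 2) ∧
    ∃ E : Set Ω, MeasurableSet E ∧ 1 - γ ≤ Pr.real E ∧
      ∀ ω ∈ E,
        (RandomEDM.edm fun i => WithLp.toLp 2 fun j => x i j ω).rank = d + 2 ∧
        RandomEDM.ObeysA0 (RandomEDM.edm fun i => WithLp.toLp 2 fun j => x i j ω)
          (RandomEDM.theta P d a / (t * ((d : ℝ) + 2))) ∧
        RandomEDM.ObeysA1 (RandomEDM.edm fun i => WithLp.toLp 2 fun j => x i j ω)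
          (RandomEDM.theta P d a / (t * √((d : ℝ) + 2))) := by
  have hd' : (0 : ℝ) < d := Nat.cast_pos.2 hd
  have hlam := RandomEDM.lambdaStar_pos hP_atomless hP_cube hd
  set B : ℝ := 1 + (d : ℝ) * a ^ 2 + (d : ℝ) ^ 2 * a ^ 4 with hBdef
  set μ : ℝ := RandomEDM.lambdaStar P d / 2 with hμdef
  have hB0 : 0 < B := by positivity
  have hμ0 : 0 < μ := half_pos hlam
  have hθ : RandomEDM.theta P d a = B / μ := by
    rw [RandomEDM.theta, hμdef, div_div_eq_mul_div, mul_comm]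
  have hθ0 : 0 < RandomEDM.theta P d a := by rw [hθ]; positivity
  obtain ⟨hN0, hexp⟩ := RandomEDM.card_mul_exp_lt (by linarith : (1 : ℝ) < d + 2) hθ0 ht hγ hN
  refine ⟨fun ω => RandomEDM.rank_edm_le _, ?_⟩
  set Z : Fin N → Ω → Option (Option (Fin d)) → ℝ :=
    fun i ω => RandomEDM.lift fun k => x i k ω with hZdef
  have hZ : ∀ i, Measurable (Z i) := fun i =>
    RandomEDM.continuous_lift.measurable.comp (measurable_pi_lambda _ fun k => hx_meas i k)
  have hZB : ∀ᵐ ω ∂Pr, ∀ i, Z i ω ⬝ᵥ Z i ω ≤ B := by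
    have h1 : ∀ i k, ∀ᵐ ω ∂Pr, |x i k ω| ≤ a := by
      intro i k
      have h2 := RandomEDM.ae_abs_le hP_cube
      rw [← hx_law i k] at h2
      exact ae_of_ae_map (hx_meas i k).aemeasurable h2
    filter_upwards [ae_all_iff.2 fun i => ae_all_iff.2 (h1 i)] with ω hω i
    exact RandomEDM.lift_dotProduct_self_le (hω i)
  have hZμ : ∀ i v, μ * (v ⬝ᵥ v) ≤ ∫ ω, (Z i ω ⬝ᵥ v) ^ 2 ∂Pr := by
    intro i v
    have hind : iIndepFun (x i) Pr :=
      hx_indep.precomp (g := fun k => (i, k)) fun k l h => (Prod.mk.inj h).2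
    simp only [hZdef, RandomEDM.lift_dotProduct]
    rw [RandomEDM.integral_sq_linear_add_sq hP_cube hm1 hm3 (hx_meas i) (hx_law i) hind]
    refine le_trans (le_of_eq ?_) (RandomEDM.lambdaStar_half_le_form P d (v none) (v (some none))
      (∑ k, v (some (some k)) ^ 2) (Finset.sum_nonneg fun k _ => sq_nonneg _))
    simp only [dotProduct, Fintype.sum_option, ← sq]
    ring
  obtain ⟨E, hE, hEγ, hEω⟩ := RandomEDM.exists_event_le_sum_sq (Pr := Pr) (γ := γ) hZ hB0 ht hZB
    (RandomEDM.indepFun_lift hx_meas hx_indep) hZμ (by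
      rw [hθ] at hexp
      have hcard : (Fintype.card (Option (Option (Fin d))) : ℝ) = d + 2 := by
        simp only [Fintype.card_option, Fintype.card_fin]; push_cast; ring
      rw [hcard, Fintype.card_fin, ← div_div_eq_mul_div]
      exact hexp)
  refine ⟨E, hE, hEγ, fun ω hω => ?_⟩
  obtain ⟨h1, h2⟩ := hEω ω hω
  rw [Fintype.card_fin] at h2
  have hc : 0 < t * N * μ := mul_pos (mul_pos ht.1 hN0) hμ0
  -- With `c = t N μ` the sample size cancels, so both constants are free of `N`.
  have e : (N : ℝ) * B / (t * N * μ) = RandomEDM.theta P d a / t := by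
    rw [hθ]
    have := ht.1.ne'
    field_simp
  have h3 := RandomEDM.edm_obeys (Nat.cast_pos.1 hN0) hc hB0 h1 h2
  rw [e, div_div, div_div] at h3
  exact h3
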